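/- Let $V$ be a finite-dimensional real Euclidean space with inner product $\langle -,-\rangle$, let $d\mu(v)=A^{-1}e^{-\frac12\langle v,v\rangle}\,dv$ with $A=\int_V e^{-\frac12\langle v,v\rangle}\,dv$ be its Gaussian probability measure, and let $V_{\mathbb C}=V\otimes\mathbb C$. For every $k\ge1$ let $S_k:V_{\mathbb C}^{\otimes k}\to\mathbb C$ be a linear map invariant under permutations of its $k$ arguments, and let $x_1,x_2,\dots$ be complex variables. By an (ordinary, closed) graph $\Gamma$ we mean a finite purely one-dimensional CW-complex without endpoints, possibly disconnected or empty, loops and multiple edges allowed: a finite set of half-edges, a map from it onto a finite set of vertices (so no vertex is isolated), and a fixed-point-free involution of the half-edges whose orbits are the edges. Isomorphisms are the compatible pairs of bijections of vertices and half-edges, and $\operatorname{Aut}\Gamma$ is the group of automorphisms. Let $Z_{x_*}(\Gamma)$ be the number obtained by placing the tensor $x_kS_k$ at every $k$-valent vertex, the Casimir element $\sum_i e_i\otimes e_i$ (for an orthonormal basis $(e_i)$ of $V$) at every edge, and contracting along the incidences. As $x_*$ varies, $Z_{x_*}(\Gamma)$ is a monomial in the $x_k$ with a complex coefficient. Then the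 asymptotic expansion $$Z(x_*):=\int_V\exp\Big\{\sum_{k=1}^\infty x_k\frac{S_k(v^{\otimes k})}{k!}\Big\}\,d\mu(v)\;=\;\sum_{\Gamma}\frac{Z_{x_*}(\Gamma)}{|\operatorname{Aut}\Gamma|},$$ where $\Gamma$ runs over all isomorphism classes of closed graphs, holds in the following two senses (and for every choice of the orthonormal basis). 1. (Formal power series.) For each $v$ expand the integrand as a formal power series in $x_1,x_2,\dots$. Each of its coefficients is a $\mu$-integrable function of $v$, and the formal power series obtained by integrating coefficientwise equals the sum on the right-hand side, which converges in $\mathbb C[[x_1,x_2,\dots]]$ (coefficientwise). 2. (Asymptotic expansion of the integral as $x_*\to0$.) Let $r_k\ge0$ $(k\ge 1)$ be such that $\sum_k r_k|S_k(v^{\otimes k})|/k!$ has finite moments of all orders with respect to $\mu$ (for instance, $r_k=0$ for all but finitely many $k$), and let $q>1$, $B\ge0$ be real and $M\ge0$ an integer. Then there is a constant $C$ such that, for all complex $x_*$ and all $0<\varepsilon\le1$ with $|x_k|\le r_k\varepsilon^k$ for every $k$ and with $\int_V\big|\exp\{\sum_k x_kS_k(v^{\otimes k})/k!\}\big|^q\,d\mu(v)\le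 B$, the function $\exp\{\sum_k x_kS_k(v^{\otimes k})/k!\}$ is $\mu$-integrable and $$\Big|\int_V\exp\Big\{\sum_{k}x_k\frac{S_k(v^{\otimes k})}{k!}\Big\}\,d\mu(v)-\sum_{\Gamma\text{ with at most }M\text{ half-edges}}\frac{Z_{x_*}(\Gamma)}{|\operatorname{Aut}\Gamma|}\Big|\le C\,\varepsilon^{M+1}.$$ -/

import Mathlib

open scoped TensorProduct MvPowerSeries.WithPiTopology

/-! ### Gaussian measure -/

section Gaussian

open MeasureTheory

/-- The Gaussian measure `dμ(v) = A⁻¹ exp(-⟨v,v⟩/2) dv`, `A = ∫ exp(-⟨v,v⟩/2) dv`, on a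
finite-dimensional Euclidean space. (Any other nontrivial translation invariant measure `dv`
gives the same `μ`.) -/
noncomputable def feynmanGaussian (V : Type*) [NormedAddCommGroup V] [InnerProductSpace ℝ V]
    [FiniteDimensional ℝ V] [MeasurableSpace V] [BorelSpace V] : Measure V :=
  (∫⁻ v : V, ENNReal.ofReal (Real.exp (-(inner ℝ v v) / 2)))⁻¹ •
    (volume : Measure V).withDensity fun v => ENNReal.ofReal (Real.exp (-(inner ℝ v v) / 2))

end Gaussian

/-! ### Symmetric algebra structures -/

/-- A sequence of symmetric tensors `S₁, S₂, …` on the complexification `V_ℂ = ℂ ⊗ V` of a real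
vector space, with values in a commutative `ℂ`-algebra `R`. For `R = ℂ` these are the linear maps
`S_k : V_ℂ^{⊗k} → ℂ` invariant under the symmetric group. -/
structure SymmetricTensors (V : Type*) [AddCommGroup V] [Module ℝ V]
    (R : Type*) [CommRing R] [Algebra ℂ R] where
  /-- the `k`-tensor, as a `ℂ`-multilinear map of `k` arguments -/
  tensor : ∀ k : ℕ+, MultilinearMap ℂ (fun _ : Fin (k : ℕ) => ℂ ⊗[ℝ] V) R
  /-- invariance under permutations of the arguments -/
  symmetric : ∀ (k : ℕ+) (σ : Equiv.Perm (Fin (k : ℕ))) (w : Fin (k : ℕ) → ℂ ⊗[ℝ] V),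
    tensor k (fun i => w (σ i)) = tensor k w

namespace SymmetricTensors

variable {V : Type*} [AddCommGroup V] [Module ℝ V] {R : Type*} [CommRing R] [Algebra ℂ R]

/-- The number `S_k(v^{⊗k})` for a real vector `v`. -/
noncomputable def diag (S : SymmetricTensors V R) (k : ℕ+) (v : V) : R :=
  S.tensor k fun _ => (1 : ℂ) ⊗ₜ[ℝ] v

/-- The rescaled sequence `x₁S₁, x₂S₂, …`; the coefficients `x_k` may be complex numbers, or
elements of any commutative `ℂ`-algebra (for instance formal variables). -/
noncomputable def scale (S : SymmetricTensors V ℂ) (x : ℕ+ → R) : SymmetricTensors V R where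
  tensor k := x k • (Algebra.linearMap ℂ R).compMultilinearMap (S.tensor k)
  symmetric k σ w := by
    simp only [_root_.smul_apply, LinearMap.compMultilinearMap_apply, S.symmetric k σ w]

/-- The number of elements of a nonempty finite set. -/
def arity (κ : Type*) [Fintype κ] [Nonempty κ] : ℕ+ := ⟨Fintype.card κ, Fintype.card_pos⟩

/-- An arbitrary enumeration of a nonempty finite set. -/
noncomputable def enum (κ : Type*) [Fintype κ] [Nonempty κ] : κ ≃ Fin (arity κ : ℕ) :=
  Fintype.equivFinOfCardEq rfl

/-- The value of the tensor of the appropriate arity on a family of vectors indexed by an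
arbitrary nonempty finite set; the enumeration used is irrelevant by symmetry. -/
noncomputable def eval (S : SymmetricTensors V R) {κ : Type*} [Fintype κ] [Nonempty κ]
    (w : κ → ℂ ⊗[ℝ] V) : R :=
  S.tensor (arity κ) fun i => w ((enum κ).symm i)

theorem eval_eq (S : SymmetricTensors V R) {κ : Type*} [Fintype κ] [Nonempty κ]
    (w : κ → ℂ ⊗[ℝ] V) (k : ℕ+) (e : κ ≃ Fin (k : ℕ)) :
    S.eval w = S.tensor k fun i => w (e.symm i) := by
  have hk : arity κ = k :=
    PNat.coe_injective ((Fintype.card_congr e).trans (Fintype.card_fin _))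
  subst hk
  have h := S.symmetric (arity κ) (e.symm.trans (enum κ)) (fun i => w ((enum κ).symm i))
  simp only [Equiv.trans_apply, Equiv.symm_apply_apply] at h
  exact h.symm

theorem eval_comp (S : SymmetricTensors V R) {κ κ' : Type*} [Fintype κ] [Nonempty κ]
    [Fintype κ'] [Nonempty κ'] (f : κ ≃ κ') (w : κ' → ℂ ⊗[ℝ] V) :
    S.eval (fun i => w (f i)) = S.eval w := by
  rw [S.eval_eq w (arity κ') (enum κ'),
    S.eval_eq (fun i => w (f i)) (arity κ') (f.trans (enum κ'))]
  simp

end SymmetricTensors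

/-! ### Closed graphs -/

/-- An ordinary closed graph, i.e. a finite purely one-dimensional CW-complex without endpoints,
possibly disconnected or empty, possibly with loops and multiple edges: a finite set of
half-edges, each attached to a vertex, and a fixed point free involution whose orbits are the
edges. No vertex is isolated. Up to isomorphism one may take `Fin numV` as the set of vertices
and `Fin numH` as the set of half-edges. -/
structure ClosedGraph where
  /-- number of vertices -/
  numV : ℕ
  /-- number of half-edges -/
  numH : ℕ
  /-- the vertex from which a half-edge stems -/
  vert : Fin numH → Fin numV
  /-- the other half of the edge to which a half-edge belongs -/
  opp : Fin numH → Fin numH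
  vert_surjective : Function.Surjective vert
  opp_opp : ∀ h, opp (opp h) = h
  opp_ne : ∀ h, opp h ≠ h

namespace ClosedGraph

/-- An isomorphism of graphs: compatible bijections of vertices and half-edges. -/
structure Iso (Γ Γ' : ClosedGraph) where
  onV : Fin Γ.numV ≃ Fin Γ'.numV
  onH : Fin Γ.numH ≃ Fin Γ'.numH
  map_vert : ∀ h, Γ'.vert (onH h) = onV (Γ.vert h)
  map_opp : ∀ h, Γ'.opp (onH h) = onH (Γ.opp h)

namespace Iso

variable {Γ Γ' Γ'' : ClosedGraph}

def refl (Γ : ClosedGraph) : Iso Γ Γ where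
  onV := Equiv.refl _
  onH := Equiv.refl _
  map_vert _ := rfl
  map_opp _ := rfl

def symm (e : Iso Γ Γ') : Iso Γ' Γ where
  onV := e.onV.symm
  onH := e.onH.symm
  map_vert h := by
    rw [Equiv.eq_symm_apply, ← e.map_vert, Equiv.apply_symm_apply]
  map_opp h := by
    rw [Equiv.eq_symm_apply, ← e.map_opp, Equiv.apply_symm_apply]

def trans (e : Iso Γ Γ') (e' : Iso Γ' Γ'') : Iso Γ Γ'' where
  onV := e.onV.trans e'.onV
  onH := e.onH.trans e'.onH
  map_vert h := by simp [e.map_vert, e'.map_vert]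
  map_opp h := by simp [e.map_opp, e'.map_opp]

theorem ext' {e e' : Iso Γ Γ'} (h1 : e.onV = e'.onV) (h2 : e.onH = e'.onH) : e = e' := by
  cases e; cases e'; simp_all

end Iso

/-- `|Aut Γ|`. -/
noncomputable def autCard (Γ : ClosedGraph) : ℕ := Nat.card (Iso Γ Γ)

/-- The half-edges stemming from the vertex `a`. -/
abbrev Star (Γ : ClosedGraph) (a : Fin Γ.numV) : Type := {h : Fin Γ.numH // Γ.vert h = a}

instance (Γ : ClosedGraph) (a : Fin Γ.numV) : Nonempty (Γ.Star a) :=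
  let ⟨h, hh⟩ := Γ.vert_surjective a
  ⟨⟨h, hh⟩⟩

/-- Assignments of basis indices to the half-edges that agree on the two halves of each edge. -/
abbrev Coloring (Γ : ClosedGraph) (ι : Type*) : Type _ :=
  {c : Fin Γ.numH → ι // ∀ h, c (Γ.opp h) = c h}

section Value

variable {V : Type*} [NormedAddCommGroup V] [InnerProductSpace ℝ V]
  {R : Type*} [CommRing R] [Algebra ℂ R] {ι : Type*} [Fintype ι]

/-- The graphical calculus `Z(Γ)`: every edge becomes a Casimir element `∑ᵢ eᵢ ⊗ eᵢ`
(for an orthonormal basis `eᵢ`), every `k`-valent vertex becomes the tensor `S_k`, and the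
vectors on the half-edges stemming from a vertex are contracted with its tensor. -/
noncomputable def value (b : OrthonormalBasis ι ℝ V) (S : SymmetricTensors V R)
    (Γ : ClosedGraph) : R := by
  classical
  exact ∑ c : Γ.Coloring ι, ∏ a : Fin Γ.numV,
    S.eval fun h : Γ.Star a => (1 : ℂ) ⊗ₜ[ℝ] b (c.1 h.1)

theorem value_eq_of_iso (b : OrthonormalBasis ι ℝ V) (S : SymmetricTensors V R)
    {Γ Γ' : ClosedGraph} (e : Iso Γ Γ') : value b S Γ = value b S Γ' := by
  classical
  unfold value
  let E : Γ.Coloring ι ≃ Γ'.Coloring ι :=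
    { toFun := fun c => ⟨fun h => c.1 (e.onH.symm h), fun h => by
        have := e.symm.map_opp h
        simp only [Iso.symm] at this
        show c.1 (e.onH.symm (Γ'.opp h)) = c.1 (e.onH.symm h)
        rw [← this, c.2]⟩
      invFun := fun c => ⟨fun h => c.1 (e.onH h), fun h => by
        show c.1 (e.onH (Γ.opp h)) = c.1 (e.onH h)
        rw [← e.map_opp, c.2]⟩
      left_inv := fun c => by ext h; simp
      right_inv := fun c => by ext h; simp }
  refine Fintype.sum_equiv E _ _ fun c => ?_
  refine Fintype.prod_equiv e.onV _ _ fun a => ?_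
  let f : Γ.Star a ≃ Γ'.Star (e.onV a) :=
    e.onH.subtypeEquiv fun h => by rw [e.map_vert, e.onV.apply_eq_iff_eq]
  rw [← S.eval_comp f]
  congr 1
  funext h
  simp [E, f]

end Value

theorem autCard_eq_of_iso {Γ Γ' : ClosedGraph} (e : Iso Γ Γ') : Γ.autCard = Γ'.autCard :=
  Nat.card_congr
    { toFun := fun s => (e.symm.trans s).trans e
      invFun := fun s => (e.trans s).trans e.symm
      left_inv := fun s => by
        apply Iso.ext' <;> ext h <;> simp [Iso.trans, Iso.symm]
      right_inv := fun s => by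
        apply Iso.ext' <;> ext h <;> simp [Iso.trans, Iso.symm] }

instance isoSetoid : Setoid ClosedGraph where
  r Γ Γ' := Nonempty (Iso Γ Γ')
  iseqv := ⟨fun Γ => ⟨Iso.refl Γ⟩, fun ⟨e⟩ => ⟨e.symm⟩, fun ⟨e⟩ ⟨e'⟩ => ⟨e.trans e'⟩⟩

end ClosedGraph

/-- The set of isomorphism classes of ordinary closed graphs. -/
def GraphClass : Type := Quotient ClosedGraph.isoSetoid

namespace GraphClass

section Term

variable {V : Type*} [NormedAddCommGroup V] [InnerProductSpace ℝ V]
  {R : Type*} [CommRing R] [Algebra ℂ R] {ι : Type*} [Fintype ι]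

/-- The contribution `Z(Γ) / |Aut Γ|` of an isomorphism class of graphs. -/
noncomputable def term (b : OrthonormalBasis ι ℝ V) (S : SymmetricTensors V R) :
    GraphClass → R :=
  Quotient.lift (fun Γ => ((Γ.autCard : ℂ)⁻¹) • Γ.value b S) fun _ _ ⟨e⟩ => by
    simp only [ClosedGraph.value_eq_of_iso b S e, ClosedGraph.autCard_eq_of_iso e]

end Term

/-- The number of half-edges (twice the number of edges). -/
def numH : GraphClass → ℕ :=
  Quotient.lift ClosedGraph.numH fun _ _ ⟨e⟩ => by simpa using Fintype.card_congr e.onH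

theorem finite_numH_le (M : ℕ) : {γ : GraphClass | γ.numH ≤ M}.Finite := by
  classical
  let D := Σ n : Fin (M + 1), Σ h : Fin (M + 1),
    (Fin h.1 → Fin n.1) × (Fin h.1 → Fin h.1)
  let F : {Γ : ClosedGraph // Γ.numH ≤ M} → D := fun Γ =>
    ⟨⟨Γ.1.numV, by
      have := Fintype.card_le_of_surjective _ Γ.1.vert_surjective
      simp only [Fintype.card_fin] at this
      have := Γ.2
      omega⟩, ⟨Γ.1.numH, by have := Γ.2; omega⟩, Γ.1.vert, Γ.1.opp⟩
  have hF : Function.Injective F := by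
    rintro ⟨⟨n, m, u, o, h1, h2, h3⟩, hm⟩ ⟨⟨n', m', u', o', h1', h2', h3'⟩, hm'⟩ h
    simp only [F, D, Sigma.mk.injEq, Fin.mk.injEq] at h
    obtain ⟨hn, h⟩ := h
    subst hn
    have h := eq_of_heq h
    rw [Sigma.mk.injEq] at h
    obtain ⟨hm2, h⟩ := h
    have hm3 : m = m' := congrArg Fin.val hm2
    subst hm3
    have h := eq_of_heq h
    rw [Prod.mk.injEq] at h
    obtain ⟨rfl, rfl⟩ := h
    rfl
  have hfin : Finite {Γ : ClosedGraph // Γ.numH ≤ M} := Finite.of_injective F hF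
  have hfin' : {Γ : ClosedGraph | Γ.numH ≤ M}.Finite := hfin
  refine (hfin'.image (Quotient.mk ClosedGraph.isoSetoid)).subset ?_
  intro γ hγ
  obtain ⟨Γ, rfl⟩ := Quotient.exists_rep γ
  exact ⟨Γ, hγ, rfl⟩

/-- The isomorphism classes of graphs with at most `M` half-edges. -/
noncomputable def upTo (M : ℕ) : Finset GraphClass := (finite_numH_le M).toFinset

end GraphClass

/-! ### The partition function -/

section Partition

open MeasureTheory

variable {V : Type*} [NormedAddCommGroup V] [InnerProductSpace ℝ V]

/-- The formal series `∑_k a_k X_k` in the variables `X₁, X₂, …`. -/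
noncomputable def linearSeries (a : ℕ+ → ℂ) : MvPowerSeries ℕ+ ℂ :=
  fun d => ∑ k ∈ d.support, if d = Finsupp.single k 1 then a k else 0

theorem constantCoeff_linearSeries (a : ℕ+ → ℂ) :
    MvPowerSeries.constantCoeff (linearSeries a) = 0 := by
  rw [← MvPowerSeries.coeff_zero_eq_constantCoeff_apply]
  simp [linearSeries, MvPowerSeries.coeff_apply]

/-- The integrand `exp {∑_k X_k S_k(v^{⊗k}) / k!}` as a formal power series in the variables
`X₁, X₂, …`, for a given vector `v`. -/
noncomputable def formalIntegrand (S : SymmetricTensors V ℂ) (v : V) : MvPowerSeries ℕ+ ℂ :=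
  (PowerSeries.exp ℂ).subst
    (linearSeries fun k => S.diag k v / ((k : ℕ).factorial : ℂ))

/-- The exponent `∑_k x_k S_k(v^{⊗k}) / k!` for complex numbers `x_k`. -/
noncomputable def exponent (S : SymmetricTensors V ℂ) (x : ℕ+ → ℂ) (v : V) : ℂ :=
  ∑' k : ℕ+, x k * (S.diag k v / ((k : ℕ).factorial : ℂ))

variable [FiniteDimensional ℝ V] [MeasurableSpace V] [BorelSpace V]

/-- The partition function as a formal power series in `X₁, X₂, …`: the formal integrand is
integrated coefficientwise against the Gaussian measure. -/
noncomputable def formalPartition (S : SymmetricTensors V ℂ) : MvPowerSeries ℕ+ ℂ :=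
  fun d => ∫ v, MvPowerSeries.coeff d (formalIntegrand S v) ∂(feynmanGaussian V)

end Partition

/-! Formal identity: fix the numbers d_k of k-valent vertices, with n = ∑ d_k vertices and m = ∑ k
d_k half-edges in total. The coefficient of x^d in the integrand is ∏ S_k(v^{⊗k})^{d_k} divided by ∏
d_k! (k!)^{d_k}. Expanding v in the orthonormal basis turns the numerator into a sum, over
colourings of the m half-edges by basis indices, of products of m coordinates of v. By Wick's
theorem (`integral_prod_coord`) each product integrates to the number of perfect matchings
compatible with the colouring. Exchanging the two sums leaves, for each matching, exactly the state
sum of a graph (`sum_value_eq_integral`).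

The denominators agree by counting labelled structures. A graph Γ has n! m! / |Aut Γ| labellings
(`LabelledGraph.card_isomorphic_mul_autCard`), and there are n! m! / ∏ d_k! (k!)^{d_k} maps from
half-edges to vertices of type d (`card_fiberSizes`). Together these give `sum_term_eq_integral`.

Analytic statement: give x_k weight k, so that a graph's monomial has as weight its number of
half-edges. Pointwise, the integrand differs from its part of weight at most M by ε^(M+1) times a
bound built from powers of the majorant and the modulus of the integrand itself
(`norm_exp_tsum_sub_sum_weightLE_le`). Young's inequality separates their product into moments of
the majorant and the q-th power of the integrand, both controlled by hypothesis. -/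

/-! ### Gaussian measure and one-dimensional moments. -/

section GaussianMoments

open MeasureTheory ProbabilityTheory

/-- Both measures have characteristic function exp(-‖t‖²/2). The gain is that `stdGaussian` is the
image of a product of one-dimensional Gaussians under any orthonormal basis, so integrals of
products of coordinates factor. -/
theorem feynmanGaussian_eq_stdGaussian (V : Type*) [NormedAddCommGroup V] [InnerProductSpace ℝ V]
    [FiniteDimensional ℝ V] [MeasurableSpace V] [BorelSpace V] :
    feynmanGaussian V = stdGaussian V := by
  have hcont : Continuous fun v : V => Real.exp (-(inner ℝ v v) / 2) := by fun_prop
  have hform : (fun v : V => Real.exp (-(inner ℝ v v) / 2)) =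
      fun v => Real.exp (-(1 / 2) * ‖v‖ ^ 2) := by
    funext v
    rw [real_inner_self_eq_norm_sq]; ring_nf
  have hpos : (0 : ℝ) < (Real.pi / (1 / 2)) ^ (Module.finrank ℝ V / 2 : ℝ) := by positivity
  have hint0 : ∫ v : V, Real.exp (-(inner ℝ v v) / 2) =
      (Real.pi / (1 / 2)) ^ (Module.finrank ℝ V / 2 : ℝ) := by
    rw [hform]
    exact GaussianFourier.integral_rexp_neg_mul_sq_norm (by norm_num)
  set A := ∫ v : V, Real.exp (-(inner ℝ v v) / 2) with hA
  have hApos : 0 < A := hint0 ▸ hpos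
  -- A non-integrable function would have integral 0 by convention, whereas the value was computed
  -- to be positive.
  have hint : Integrable fun v : V => Real.exp (-(inner ℝ v v) / 2) := by
    by_contra h
    rw [hA, integral_undef h] at hApos
    exact lt_irrefl _ hApos
  have hlint : (∫⁻ v : V, ENNReal.ofReal (Real.exp (-(inner ℝ v v) / 2))) = ENNReal.ofReal A := by
    rw [hA, ofReal_integral_eq_lintegral_ofReal hint]
    exact Filter.Eventually.of_forall fun v => (Real.exp_pos _).le
  have hfin : IsProbabilityMeasure (feynmanGaussian V) := by
    constructor
    rw [feynmanGaussian, Measure.smul_apply, withDensity_apply _ MeasurableSet.univ,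
      Measure.restrict_univ, smul_eq_mul, hlint]
    exact ENNReal.inv_mul_cancel (by simpa using hApos) ENNReal.ofReal_ne_top
  refine Measure.ext_of_charFun ?_
  funext t
  rw [charFun_stdGaussian, charFun_apply, feynmanGaussian, integral_smul_measure, hlint,
    integral_withDensity_eq_integral_toReal_smul (by fun_prop)
      (Filter.Eventually.of_forall fun _ => ENNReal.ofReal_lt_top)]
  have h1 : ∀ v : V, (ENNReal.ofReal (Real.exp (-(inner ℝ v v) / 2))).toReal •
      Complex.exp (inner ℝ v t * Complex.I) =
      Complex.exp (-(1 / 2 : ℂ) * ‖v‖ ^ 2 + Complex.I * inner ℝ t v) := by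
    intro v
    rw [ENNReal.toReal_ofReal (Real.exp_pos _).le, Complex.real_smul, Complex.ofReal_exp,
      ← Complex.exp_add, real_inner_comm t v, real_inner_self_eq_norm_sq]
    congr 1
    push_cast
    ring
  simp_rw [h1]
  rw [GaussianFourier.integral_cexp_neg_mul_sq_norm_add (by norm_num), hint0]
  rw [ENNReal.toReal_inv, ENNReal.toReal_ofReal hpos.le, Complex.real_smul]
  have h2 : (((Real.pi / (1 / 2)) ^ (Module.finrank ℝ V / 2 : ℝ) : ℝ) : ℂ) =
      (Real.pi / (1 / 2 : ℂ)) ^ (Module.finrank ℝ V / 2 : ℂ) := by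
    rw [Complex.ofReal_cpow (by positivity)]
    push_cast
    rfl
  rw [Complex.ofReal_inv, ← h2, ← mul_assoc, inv_mul_cancel₀ (by exact_mod_cast hpos.ne'), one_mul]
  congr 1
  rw [Complex.I_sq]
  ring

instance (V : Type*) [NormedAddCommGroup V] [InnerProductSpace ℝ V]
    [FiniteDimensional ℝ V] [MeasurableSpace V] [BorelSpace V] :
    IsProbabilityMeasure (feynmanGaussian V) := by
  rw [feynmanGaussian_eq_stdGaussian]; infer_instance

theorem integrable_pow_gaussianReal (n : ℕ) :
    Integrable (fun x : ℝ => x ^ n) (gaussianReal 0 1) := by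
  have h := (memLp_id_gaussianReal (μ := 0) (v := 1) (n : NNReal)).integrable_norm_pow'
  refine (integrable_norm_iff (by fun_prop)).mp ?_
  simpa using h

/-- The even moments of the standard Gaussian. -/
theorem integral_pow_gaussianReal_even (k : ℕ) :
    ∫ x : ℝ, x ^ (2 * k) ∂(gaussianReal 0 1) = ((2 * k).factorial : ℝ) / (2 ^ k * k.factorial) := by
  have hI : ∀ k : ℕ, ∫ x : ℝ, x ^ (2 * k) ∂(gaussianReal 0 1) =
      2 ^ k * Real.Gamma (k + 1 / 2) / √Real.pi := by
    intro k
    rw [integral_gaussianReal_eq_integral_smul one_ne_zero]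
    -- The integrand is even; written as a function of |x| it reduces to the half-line integral
    -- defining Γ.
    have h1 : ∀ x : ℝ, gaussianPDFReal 0 1 x • x ^ (2 * k) =
        (√(2 * Real.pi))⁻¹ * (fun y : ℝ => y ^ (2 * k) * Real.exp (-(1 / 2) * y ^ (2 : ℝ))) |x| := by
      intro x
      simp only [gaussianPDFReal, smul_eq_mul, NNReal.coe_one, Real.rpow_two, sq_abs, mul_one,
        sub_zero, pow_mul]
      ring_nf
    simp_rw [h1]
    rw [integral_const_mul, integral_comp_abs (f := fun y : ℝ => y ^ (2 * k) *
      Real.exp (-(1 / 2) * y ^ (2 : ℝ)))]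
    have h2 := integral_rpow_mul_exp_neg_mul_rpow (p := 2) (q := (2 * k : ℕ)) (b := 1 / 2)
      (by norm_num) (by have : (0 : ℝ) ≤ (2 * k : ℕ) := by positivity
                        linarith) (by norm_num)
    simp_rw [Real.rpow_natCast] at h2
    rw [h2]
    have h3 : ((2 * k : ℕ) + 1 : ℝ) / 2 = k + 1 / 2 := by push_cast; ring
    have h4 : (1 / 2 : ℝ) ^ (-((2 * k : ℕ) + 1 : ℝ) / 2) = 2 ^ k * √2 := by
      rw [neg_div, h3, Real.rpow_neg (by norm_num), one_div, Real.inv_rpow (by norm_num), inv_inv,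
        Real.rpow_add (by norm_num), Real.rpow_natCast, Real.sqrt_eq_rpow, one_div]
    rw [h3, h4, Real.sqrt_mul (by norm_num)]
    have : √2 ≠ 0 := by positivity
    have : √Real.pi ≠ 0 := by positivity
    field_simp
  rw [hI]
  induction k with
  | zero =>
    have : √Real.pi ≠ 0 := by positivity
    rw [Nat.cast_zero, zero_add, Real.Gamma_one_half_eq]
    simp [this]
  | succ k ih =>
    have h5 : ((k + 1 : ℕ) : ℝ) + 1 / 2 = (k + 1 / 2) + 1 := by push_cast; ring
    rw [h5, Real.Gamma_add_one (by positivity), pow_succ,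
      show 2 ^ k * 2 * ((k + 1 / 2) * Real.Gamma (k + 1 / 2)) / √Real.pi =
      (2 * k + 1) * (2 ^ k * Real.Gamma (k + 1 / 2) / √Real.pi) by ring, ih,
      show 2 * (k + 1) = 2 * k + 1 + 1 by ring, Nat.factorial_succ, Nat.factorial_succ,
      Nat.factorial_succ]
    push_cast
    field_simp
    ring

theorem integral_pow_gaussianReal_odd (k : ℕ) :
    ∫ x : ℝ, x ^ (2 * k + 1) ∂(gaussianReal 0 1) = 0 := by
  have h := integral_map (μ := gaussianReal 0 1) (φ := fun x : ℝ => -x) (by fun_prop)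
    (f := fun x : ℝ => x ^ (2 * k + 1)) (by fun_prop)
  rw [gaussianReal_map_neg, neg_zero] at h
  simp_rw [Odd.neg_pow (⟨k, rfl⟩ : Odd (2 * k + 1)), integral_neg] at h
  linarith

end GaussianMoments

/-! ### Perfect matchings and Wick's theorem. -/

section Pairings

/-- A perfect matching of a set, given as a fixed point free involution. -/
def IsPairing {H : Type*} (o : H → H) : Prop := (∀ h, o (o h) = h) ∧ ∀ h, o h ≠ h

open Equiv.Perm in
-- A pairing of 2k points is a permutation whose cycle type is k transpositions, so the count is the
-- size of a conjugacy class of the symmetric group.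
theorem card_pairings (H : Type*) [Fintype H] :
    (Nat.card {o : H → H // IsPairing o} : ℝ) =
      if Even (Fintype.card H) then
        ((Fintype.card H).factorial : ℝ) /
          (2 ^ (Fintype.card H / 2) * (Fintype.card H / 2).factorial) else 0 := by
  classical
  set k := Fintype.card H / 2 with hk
  have e : Nat.card {o : H → H // IsPairing o} =
      if Even (Fintype.card H) then
        (Finset.univ.filter fun g : Equiv.Perm H => g.cycleType = Multiset.replicate k 2).card
      else 0 := by
    have key : ∀ g : Equiv.Perm H, IsPairing g ↔
        (Even (Fintype.card H) ∧ g.cycleType = Multiset.replicate k 2) := by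
      intro g
      constructor
      · rintro ⟨h1, h2⟩
        have hg : g ^ 2 = 1 := by ext h; simp [pow_two, h1]
        have hc := cycleType_of_pow_prime_eq_one (p := 2) hg
        have hs : g.support = Finset.univ := by
          ext h; simp [Equiv.Perm.mem_support, h2]
        have hsum := sum_cycleType g
        rw [hs, Finset.card_univ, hc, Multiset.sum_replicate, smul_eq_mul] at hsum
        refine ⟨⟨g.cycleType.card, by omega⟩, ?_⟩
        rw [hc]; congr 1; omega
      · rintro ⟨⟨j, hj⟩, h⟩
        have hg : g ^ 2 = 1 := pow_prime_eq_one_iff.mpr fun c hc => by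
          rw [h] at hc; exact Multiset.eq_of_mem_replicate hc
        have hsum := sum_cycleType g
        rw [h, Multiset.sum_replicate, smul_eq_mul] at hsum
        have hs : g.support = Finset.univ := by
          apply Finset.eq_univ_of_card; omega
        refine ⟨fun h => by simpa [pow_two] using congrArg (fun g => g h) hg, fun h => ?_⟩
        rw [← Equiv.Perm.mem_support, hs]; simp
    let E : {o : H → H // IsPairing o} ≃ {g : Equiv.Perm H // IsPairing g} :=
      { toFun := fun o => ⟨Function.Involutive.toPerm o.1 o.2.1, o.2⟩
        invFun := fun g => ⟨g.1, g.2⟩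
        left_inv := fun _ => rfl
        right_inv := fun _ => by ext; rfl }
    rw [Nat.card_congr E]
    split_ifs with hev
    · simp only [key, hev, true_and]
      rw [Nat.card_eq_fintype_card, Fintype.card_subtype]
    · simp [key, hev]
  rw [e]
  split_ifs with hev
  · obtain ⟨j, hj⟩ := hev
    have h := card_of_cycleType_mul_eq H (Multiset.replicate k 2)
    rw [if_pos ⟨by simp; omega, fun a ha => (Multiset.eq_of_mem_replicate ha).ge⟩] at h
    have h0 : Fintype.card H - (Multiset.replicate k 2).sum = 0 := by simp; omega
    rw [h0, Multiset.prod_replicate] at h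
    have h1 : ∏ n ∈ (Multiset.replicate k 2).toFinset,
        (Multiset.count n (Multiset.replicate k 2)).factorial = k.factorial := by
      rcases Nat.eq_zero_or_pos k with h0 | h0
      · simp [h0]
      · rw [Multiset.toFinset_replicate, if_neg h0.ne']; simp
    rw [h1] at h
    rw [eq_div_iff (by positivity), ← h]
    push_cast; simp
  · simp

open MeasureTheory ProbabilityTheory in
theorem integral_pow_gaussianReal_eq_card_pairings (H : Type*) [Fintype H] :
    ∫ x : ℝ, x ^ (Fintype.card H) ∂(gaussianReal 0 1) =
      Nat.card {o : H → H // IsPairing o} := by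
  rw [card_pairings]
  split_ifs with h
  · obtain ⟨j, hj⟩ := h
    rw [hj, ← two_mul, integral_pow_gaussianReal_even, Nat.mul_div_cancel_left _ two_pos]
  · rw [Nat.not_even_iff_odd] at h
    obtain ⟨j, hj⟩ := h
    rw [hj, integral_pow_gaussianReal_odd]

/-- A pairing preserving a colouring is a family of pairings of the colour classes. -/
def pairingEquivPi {H ι : Type*} (c : H → ι) :
    {o : H → H // IsPairing o ∧ ∀ h, c (o h) = c h} ≃
      ∀ i, {o : {h // c h = i} → {h // c h = i} // IsPairing o} where
  toFun o i := ⟨fun h => ⟨o.1 h.1, (o.2.2 h.1).trans h.2⟩,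
    fun h => Subtype.ext (o.2.1.1 h.1), fun h e => o.2.1.2 h.1 (congrArg Subtype.val e)⟩
  invFun p := ⟨fun h => ((p (c h)).1 ⟨h, rfl⟩).1, by
    -- The partner of `h` has the colour of `h` only up to a propositional equality, so applying the
    -- family twice requires changing the index of the class.
    have aux : ∀ (i : ι) (h : H) (e : c h = i), ((p (c h)).1 ⟨h, rfl⟩).1 = ((p i).1 ⟨h, e⟩).1 := by
      rintro i h rfl; rfl
    refine ⟨⟨fun h => ?_, fun h e => ?_⟩, fun h => ((p (c h)).1 ⟨h, rfl⟩).2⟩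
    · refine (aux _ _ ((p (c h)).1 ⟨h, rfl⟩).2).trans ?_
      exact congrArg Subtype.val ((p (c h)).2.1 ⟨h, rfl⟩)
    · exact (p (c h)).2.2 ⟨h, rfl⟩ (Subtype.ext e)⟩
  left_inv o := rfl
  right_inv p := by
    funext i
    apply Subtype.ext
    funext ⟨h, e⟩
    subst e
    rfl

open MeasureTheory ProbabilityTheory

variable {V : Type*} [NormedAddCommGroup V] [InnerProductSpace ℝ V] {ι : Type*} [Fintype ι]

theorem prod_coord_sum_smul (b : OrthonormalBasis ι ℝ V) {H : Type*} [Fintype H] (c : H → ι)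
    (x : ι → ℝ) :
    ∏ h, inner ℝ (b (c h)) (∑ i, x i • b i) = ∏ i, x i ^ Nat.card {h // c h = i} := by
  classical
  have h1 : ∀ h, inner ℝ (b (c h)) (∑ i, x i • b i) = x (c h) := fun h => by
    rw [b.orthonormal.inner_right_fintype]
  simp_rw [h1]
  rw [← Finset.prod_fiberwise_of_maps_to' (g := c) (t := Finset.univ) fun _ _ => Finset.mem_univ _]
  refine Finset.prod_congr rfl fun i _ => ?_
  rw [Finset.prod_const, Nat.card_eq_fintype_card, Fintype.card_subtype]

variable [FiniteDimensional ℝ V] [MeasurableSpace V] [BorelSpace V]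

theorem integrable_prod_coord (b : OrthonormalBasis ι ℝ V) {H : Type*} [Fintype H] (c : H → ι) :
    Integrable (fun v => ∏ h, inner ℝ (b (c h)) v) (feynmanGaussian V) := by
  rw [feynmanGaussian_eq_stdGaussian, stdGaussian_eq_map_pi_orthonormalBasis b,
    integrable_map_measure (by fun_prop) (Measurable.aemeasurable (by fun_prop))]
  simp only [Function.comp_def, prod_coord_sum_smul]
  exact Integrable.fintype_prod (f := fun i (x : ℝ) => x ^ Nat.card {h // c h = i})
    fun i => integrable_pow_gaussianReal _

/-- **Wick's theorem** for products of coordinate functions. -/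
theorem integral_prod_coord (b : OrthonormalBasis ι ℝ V) {H : Type*} [Fintype H] (c : H → ι) :
    ∫ v, ∏ h, inner ℝ (b (c h)) v ∂(feynmanGaussian V) =
      Nat.card {o : H → H // IsPairing o ∧ ∀ h, c (o h) = c h} := by
  classical
  rw [feynmanGaussian_eq_stdGaussian, stdGaussian_eq_map_pi_orthonormalBasis b,
    integral_map (Measurable.aemeasurable (by fun_prop)) (by fun_prop)]
  simp only [prod_coord_sum_smul]
  -- The coordinates are independent: the integral is a product over colours of one-dimensional
  -- moments, each counting the pairings of one colour class.
  rw [integral_fintype_prod_eq_prod (fun i (x : ℝ) => x ^ Nat.card {h // c h = i}),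
    Nat.card_congr (pairingEquivPi c), Nat.card_pi]
  push_cast
  refine Finset.prod_congr rfl fun i _ => ?_
  rw [Nat.card_eq_fintype_card]
  exact integral_pow_gaussianReal_eq_card_pairings _

end Pairings

/-! ### Multinomial coefficients: exponential of a linear form, and words. -/

section Counting

/-- Lowering one exponent affects one factor only. In the recursion below `c` is `d k` for a product
of factorials and `a k` for a monomial. -/
theorem Finsupp.prod_eq_mul_prod_tsub_single {α R : Type*} [CommMonoid R] (g : α → ℕ → R)
    (hg : ∀ k, g k 0 = 1) (d : α →₀ ℕ) (k : α) (c : R)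
    (hc : g k (d k) = c * g k (d k - 1)) :
    d.prod g = c * (d - Finsupp.single k 1).prod g := by
  classical
  have he : (d - Finsupp.single k 1).erase k = d.erase k := by
    ext j
    by_cases hj : j = k
    · rw [hj, Finsupp.erase_same, Finsupp.erase_same]
    · simp [Finsupp.erase_ne hj, Ne.symm hj]
  rw [← Finsupp.mul_prod_erase' d k g hg,
    ← Finsupp.mul_prod_erase' (d - Finsupp.single k 1) k g hg, hc, mul_assoc, he]
  simp

/-- The recursion solved by the coefficients of the powers of a linear form. -/
theorem multinomial_recursion {α : Type*} (a : α → ℂ) (u : ℕ → (α →₀ ℕ) → ℂ)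
    (h0 : u 0 0 = 1) (h0' : ∀ d, d ≠ 0 → u 0 d = 0)
    (hs : ∀ n d, u (n + 1) d = ∑ k ∈ d.support, a k * u n (d - Finsupp.single k 1))
    (n : ℕ) (d : α →₀ ℕ) :
    u n d * (d.prod fun _ j => (j.factorial : ℂ)) =
      if d.degree = n then n.factorial * d.prod (fun k j => a k ^ j) else 0 := by
  classical
  induction n generalizing d with
  | zero =>
    by_cases hd : d = 0
    · subst hd; simp [h0]
    · simp [h0' d hd, hd, Finsupp.degree_eq_zero_iff]
  | succ n ih =>
    rw [hs, Finset.sum_mul]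
    -- After multiplication by ∏ d_j!, the k-th summand is d_k times a quantity independent of k.
    -- Summing d_k over k gives the degree n + 1, which raises n! to (n + 1)!.
    have key : ∀ k ∈ d.support,
        a k * u n (d - Finsupp.single k 1) * (d.prod fun _ j => (j.factorial : ℂ)) =
        d k * (if d.degree = n + 1 then n.factorial * d.prod (fun k j => a k ^ j) else 0) := by
      intro k hk
      have hk0 : d k ≠ 0 := Finsupp.mem_support_iff.mp hk
      rw [Finsupp.prod_eq_mul_prod_tsub_single (fun _ j => (j.factorial : ℂ)) (by simp) d k (d k)
          (by rw [← Nat.cast_mul, Nat.mul_factorial_pred hk0]),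
        Finsupp.prod_eq_mul_prod_tsub_single (fun k j => a k ^ j) (by simp) d k (a k)
          (by rw [← pow_succ', Nat.sub_add_cancel (Nat.pos_of_ne_zero hk0)]),
        show ∀ x y z w : ℂ, x * y * (z * w) = z * (x * (y * w)) by intros; ring, ih]
      have hdeg : d.degree = (d - Finsupp.single k 1).degree + 1 := by
        have h : d - Finsupp.single k 1 + Finsupp.single k 1 = d :=
          tsub_add_cancel_of_le (Finsupp.single_le_iff.mpr (Nat.pos_of_ne_zero hk0))
        conv_lhs => rw [← h]
        simp
      congr 1
      by_cases h : (d - Finsupp.single k 1).degree = n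
      · rw [if_pos h, if_pos (by omega)]; ring
      · rw [if_neg h, if_neg (by omega)]; ring
    rw [Finset.sum_congr rfl key, ← Finset.sum_mul]
    split_ifs with h
    · have h2 : (∑ k ∈ d.support, (d k : ℂ)) = n + 1 := by
        rw [Finsupp.degree_apply] at h
        exact_mod_cast h
      rw [h2, Nat.factorial_succ]; push_cast; ring
    · ring

theorem coeff_linearSeries_mul (a : ℕ+ → ℂ) (g : MvPowerSeries ℕ+ ℂ) (d : ℕ+ →₀ ℕ) :
    MvPowerSeries.coeff d (linearSeries a * g) =
      ∑ k ∈ d.support, a k * MvPowerSeries.coeff (d - Finsupp.single k 1) g := by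
  classical
  rw [MvPowerSeries.coeff_mul]
  have h1 : ∀ p ∈ Finset.HasAntidiagonal.antidiagonal d,
      MvPowerSeries.coeff p.1 (linearSeries a) * MvPowerSeries.coeff p.2 g =
      ∑ k ∈ d.support, if p.1 = Finsupp.single k 1 then a k * MvPowerSeries.coeff p.2 g else 0 := by
    intro p hp
    have hp' : p.1 + p.2 = d := Finset.HasAntidiagonal.mem_antidiagonal.mp hp
    have hsub : p.1.support ⊆ d.support := by
      rw [← hp']
      exact Finsupp.support_mono (self_le_add_right _ _)
    rw [MvPowerSeries.coeff_apply, linearSeries, Finset.sum_mul,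
      Finset.sum_subset hsub fun k _ hk => ?_]
    · exact Finset.sum_congr rfl fun k _ => by rw [ite_mul, zero_mul]
    · rw [if_neg, zero_mul]
      intro h
      rw [h] at hk
      simp at hk
  rw [Finset.sum_congr rfl h1, Finset.sum_comm]
  refine Finset.sum_congr rfl fun k hk => ?_
  have hle : Finsupp.single k 1 ≤ d := by
    exact Finsupp.single_le_iff.mpr (Nat.pos_of_ne_zero (Finsupp.mem_support_iff.mp hk))
  rw [Finset.sum_eq_single (Finsupp.single k 1, d - Finsupp.single k 1)]
  · simp
  · rintro ⟨p, q⟩ hp hne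
    rw [if_neg]
    rintro rfl
    apply hne
    rw [← Finset.HasAntidiagonal.mem_antidiagonal.mp hp]
    simp
  · intro h
    exact absurd (Finset.HasAntidiagonal.mem_antidiagonal.mpr (add_tsub_cancel_of_le hle)) h

theorem coeff_linearSeries_pow (a : ℕ+ → ℂ) (n : ℕ) (d : ℕ+ →₀ ℕ) :
    MvPowerSeries.coeff d (linearSeries a ^ n) * (d.prod fun _ j => (j.factorial : ℂ)) =
      if d.degree = n then n.factorial * d.prod (fun k j => a k ^ j) else 0 := by
  classical
  refine multinomial_recursion a (fun n d => MvPowerSeries.coeff d (linearSeries a ^ n))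
    (by simp) (fun d hd => by simp [MvPowerSeries.coeff_one, hd]) (fun n d => ?_) n d
  rw [pow_succ', coeff_linearSeries_mul]

theorem prod_factorial_ne_zero {α : Type*} (d : α →₀ ℕ) :
    (d.prod fun _ j => (j.factorial : ℂ)) ≠ 0 :=
  Finset.prod_ne_zero_iff.mpr fun _ _ => Nat.cast_ne_zero.mpr (Nat.factorial_ne_zero _)

/-- The linear form is homogeneous, so only its power of exponent `d.degree` reaches the monomial d,
and the factorial of that degree cancels against the exponential series. -/
theorem coeff_exp_subst_linearSeries (a : ℕ+ → ℂ) (d : ℕ+ →₀ ℕ) :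
    MvPowerSeries.coeff d ((PowerSeries.exp ℂ).subst (linearSeries a)) =
      d.prod (fun k j => a k ^ j) / (d.prod fun _ j => (j.factorial : ℂ)) := by
  rw [PowerSeries.coeff_subst
    (PowerSeries.HasSubst.of_constantCoeff_zero (constantCoeff_linearSeries a)),
    finsum_eq_single _ d.degree]
  · rw [eq_div_iff (prod_factorial_ne_zero d), smul_mul_assoc, coeff_linearSeries_pow, if_pos rfl,
      PowerSeries.coeff_exp, smul_eq_mul, ← mul_assoc]
    have : (d.degree.factorial : ℂ) ≠ 0 := by exact_mod_cast (Nat.factorial_pos _).ne'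
    simp [this]
  · intro n hn
    have h := coeff_linearSeries_pow a n d
    rw [if_neg hn.symm, mul_eq_zero, or_iff_left (prod_factorial_ne_zero d)] at h
    rw [h, smul_zero]

theorem mem_support_of_sum_single {α : Type*} {n : ℕ} {f : Fin n → α} {d : α →₀ ℕ}
    (hf : ∑ i, Finsupp.single (f i) 1 = d) (i : Fin n) : f i ∈ d.support := by
  rw [Finsupp.mem_support_iff, ← hf, Finsupp.finsetSum_apply]
  refine (Finset.sum_pos' (fun _ _ => Nat.zero_le _) ⟨i, Finset.mem_univ _, ?_⟩).ne'
  simp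

/-- Words of length `n` with prescribed letter multiplicities, split at the first letter. -/
noncomputable def consWordEquiv {α : Type*} (n : ℕ) (d : α →₀ ℕ) :
    {f : Fin (n + 1) → α // ∑ i, Finsupp.single (f i) 1 = d} ≃
      Σ k : d.support, {f : Fin n → α // ∑ i, Finsupp.single (f i) 1 = d - Finsupp.single k.1 1} where
  toFun f := ⟨⟨f.1 0, mem_support_of_sum_single f.2 0⟩, ⟨fun i => f.1 i.succ, by
      have h := f.2
      rw [Fin.sum_univ_succ] at h
      exact (tsub_eq_of_eq_add_rev h.symm).symm⟩⟩
  invFun p := ⟨Fin.cons p.1.1 p.2.1, by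
    rw [Fin.sum_univ_succ]
    simp only [Fin.cons_zero, Fin.cons_succ]
    rw [p.2.2, add_tsub_cancel_of_le]
    rw [Finsupp.single_le_iff]
    exact Nat.pos_of_ne_zero (Finsupp.mem_support_iff.mp p.1.2)⟩
  left_inv f := Subtype.ext (Fin.cons_self_tail f.1)
  right_inv p := by
    rcases p with ⟨k, f, hf⟩
    rfl

instance finite_words {α : Type*} (n : ℕ) (d : α →₀ ℕ) :
    Finite {f : Fin n → α // ∑ i, Finsupp.single (f i) 1 = d} := by
  refine Finite.of_injective (β := Fin n → d.support)
    (fun f i => ⟨f.1 i, mem_support_of_sum_single f.2 i⟩) fun f g h => ?_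
  apply Subtype.ext
  funext i
  exact congrArg Subtype.val (congrFun h i)

/-- Splitting off the first letter gives the same recursion as for powers of a linear form with all
coefficients 1. -/
theorem card_words {α : Type*} (d : α →₀ ℕ) :
    (Nat.card {f : Fin d.degree → α // ∑ i, Finsupp.single (f i) 1 = d} : ℂ) *
      (d.prod fun _ j => (j.factorial : ℂ)) = d.degree.factorial := by
  classical
  have h := multinomial_recursion (α := α) (fun _ => 1)
    (fun n d => Nat.card {f : Fin n → α // ∑ i, Finsupp.single (f i) 1 = d})
    (by simp) (fun d hd => by simp [hd.symm]) (fun n d => ?_) d.degree d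
  · rw [h]; simp
  · rw [Nat.card_congr (consWordEquiv n d), Nat.card_sigma]
    push_cast
    simp only [one_mul]
    exact Finset.sum_coe_sort d.support fun k => (Nat.card
      {f : Fin n → α // ∑ i, Finsupp.single (f i) 1 = d - Finsupp.single k 1} : ℂ)

end Counting

/-! ### Counting maps with prescribed fibre sizes. -/

section DegreeSequence

/-- The multiset of sizes of the fibres of a (surjective) map, as a finitely supported function. -/
noncomputable def fiberSizes {m n : ℕ} (f : Fin m → Fin n) : ℕ+ →₀ ℕ :=
  ∑ a, Finsupp.single (Nat.card {h // f h = a}).toPNat' 1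

/-- The number of half-edges of a graph with `d k` vertices of valency `k`. -/
def halfEdges (d : ℕ+ →₀ ℕ) : ℕ := d.sum fun k j => k * j

theorem sum_single_eq_iff {m n : ℕ} (f : Fin m → Fin n) (s : Fin n → ℕ) :
    ∑ h, Finsupp.single (f h) 1 = Finsupp.equivFunOnFinite.symm s ↔
      ∀ a, Nat.card {h // f h = a} = s a := by
  classical
  rw [Finsupp.ext_iff]
  refine forall_congr' fun a => ?_
  rw [Finsupp.finsetSum_apply, Nat.card_eq_fintype_card, Fintype.card_subtype, Finset.card_filter]
  simp [Finsupp.single_apply]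

/-- Surjective maps with given fibre sizes, sorted by the sizes of the individual fibres. -/
noncomputable def fiberSizesEquiv (m n : ℕ) (d : ℕ+ →₀ ℕ) :
    {f : Fin m → Fin n // Function.Surjective f ∧ fiberSizes f = d} ≃
      Σ s : {s : Fin n → ℕ+ // ∑ a, Finsupp.single (s a) 1 = d},
        {f : Fin m → Fin n // ∑ h, Finsupp.single (f h) 1 =
          Finsupp.equivFunOnFinite.symm fun a => (s.1 a : ℕ)} where
  toFun f := ⟨⟨fun a => (Nat.card {h // f.1 h = a}).toPNat', f.2.2⟩, f.1, by
    rw [sum_single_eq_iff]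
    intro a
    -- Surjectivity keeps the fibre nonempty; otherwise `toPNat'` would replace its size 0 by 1.
    obtain ⟨h, hh⟩ := f.2.1 a
    have : Nonempty {h // f.1 h = a} := ⟨⟨h, hh⟩⟩
    exact (PNat.toPNat'_coe Nat.card_pos).symm⟩
  invFun p := ⟨p.2.1, fun a => by
      have h := (sum_single_eq_iff p.2.1 _).mp p.2.2 a
      have : Nonempty {h // p.2.1 h = a} := by
        by_contra hc
        rw [not_nonempty_iff] at hc
        rw [Nat.card_of_isEmpty] at h
        exact (p.1.1 a).pos.ne h
      exact ⟨this.some.1, this.some.2⟩, by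
      refine Eq.trans ?_ p.1.2
      refine Finset.sum_congr rfl fun a _ => ?_
      rw [(sum_single_eq_iff p.2.1 _).mp p.2.2 a, PNat.coe_toPNat']⟩
  left_inv f := rfl
  right_inv p := by
    rcases p with ⟨⟨s, hs⟩, f, hf⟩
    have : s = fun a => (Nat.card {h // f h = a}).toPNat' := by
      funext a
      rw [(sum_single_eq_iff f _).mp hf a, PNat.coe_toPNat']
    subst this
    rfl

theorem prod_eq_prod_of_sum_single {n : ℕ} {R : Type*} [CommMonoid R] (g : ℕ+ → R)
    (s : Fin n → ℕ+) (d : ℕ+ →₀ ℕ) (hs : ∑ a, Finsupp.single (s a) 1 = d) :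
    ∏ a, g (s a) = d.prod fun k j => g k ^ j := by
  classical
  rw [← hs, ← Finsupp.prod_finsetSum_index (by simp) (by simp [pow_add])]
  simp

theorem degree_eq_of_sum_single {n : ℕ} (s : Fin n → ℕ+) (d : ℕ+ →₀ ℕ)
    (hs : ∑ a, Finsupp.single (s a) 1 = d) : d.degree = n := by
  rw [← hs, map_sum]; simp

theorem halfEdges_eq_of_sum_single {n : ℕ} (s : Fin n → ℕ+) (d : ℕ+ →₀ ℕ)
    (hs : ∑ a, Finsupp.single (s a) 1 = d) : halfEdges d = ∑ a, (s a : ℕ) := by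
  rw [halfEdges, ← hs, ← Finsupp.sum_finsetSum_index (by simp) (by simp [mul_add])]
  simp

/-- Two word counts multiply. The list of valencies of the vertices is a word with letter
multiplicities d, giving n! / ∏ d_k! choices. For a fixed list, the map itself is a word of length m
in the vertices with these multiplicities, giving m! / ∏ (k!)^{d_k} choices. -/
theorem card_fiberSizes (d : ℕ+ →₀ ℕ) :
    (Nat.card {f : Fin (halfEdges d) → Fin d.degree //
      Function.Surjective f ∧ fiberSizes f = d} : ℂ) *
      ((d.prod fun _ j => (j.factorial : ℂ)) *
        d.prod fun k j => ((k : ℕ).factorial : ℂ) ^ j) =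
      d.degree.factorial * (halfEdges d).factorial := by
  classical
  rw [Nat.card_congr (fiberSizesEquiv _ _ d)]
  have : Fintype {s : Fin d.degree → ℕ+ // ∑ a, Finsupp.single (s a) 1 = d} := Fintype.ofFinite _
  rw [Nat.card_sigma]
  push_cast
  have h1 : ∀ s : {s : Fin d.degree → ℕ+ // ∑ a, Finsupp.single (s a) 1 = d},
      (Nat.card {f : Fin (halfEdges d) → Fin d.degree // ∑ h, Finsupp.single (f h) 1 =
          Finsupp.equivFunOnFinite.symm fun a => (s.1 a : ℕ)} : ℂ) *
        (d.prod fun k j => ((k : ℕ).factorial : ℂ) ^ j) = (halfEdges d).factorial := by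
    rintro ⟨s, hs⟩
    have hdeg : (Finsupp.equivFunOnFinite.symm fun a => (s a : ℕ)).degree = halfEdges d := by
      rw [halfEdges_eq_of_sum_single s d hs, Finsupp.degree_eq_sum]; rfl
    have h2 := card_words (Finsupp.equivFunOnFinite.symm fun a => (s a : ℕ))
    rw [hdeg] at h2
    rw [← h2, ← prod_eq_prod_of_sum_single (fun k => ((k : ℕ).factorial : ℂ)) s d hs,
      Finsupp.prod_fintype _ _ (by simp)]
    rfl
  rw [mul_comm (d.prod fun _ j => (j.factorial : ℂ)), ← mul_assoc, Finset.sum_mul,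
    Finset.sum_congr rfl fun s _ => h1 s, Finset.sum_const, nsmul_eq_mul, Finset.card_univ,
    ← Nat.card_eq_fintype_card, mul_right_comm, card_words]

end DegreeSequence

theorem SymmetricTensors.toPNat'_natCard (κ : Type*) [Fintype κ] [Nonempty κ] :
    (Nat.card κ).toPNat' = SymmetricTensors.arity κ := by
  apply PNat.coe_injective
  rw [PNat.toPNat'_coe Nat.card_pos, Nat.card_eq_fintype_card]
  rfl

/-! ### Valencies, monomials and isomorphisms of graphs. -/

namespace ClosedGraph

/-- The number of vertices of each valency. -/
noncomputable def valencies (Γ : ClosedGraph) : ℕ+ →₀ ℕ := fiberSizes Γ.vert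

theorem sum_single_arity (Γ : ClosedGraph) [∀ a, Fintype (Γ.Star a)] :
    ∑ a, Finsupp.single (SymmetricTensors.arity (Γ.Star a)) 1 = Γ.valencies :=
  Finset.sum_congr rfl fun a _ => by
    rw [← SymmetricTensors.toPNat'_natCard]

theorem Iso.valencies_eq {Γ Γ' : ClosedGraph} (e : Iso Γ Γ') : Γ.valencies = Γ'.valencies := by
  refine Fintype.sum_equiv e.onV _ _ fun a => ?_
  congr 2
  exact Nat.card_congr (e.onH.subtypeEquiv fun h => by rw [e.map_vert, e.onV.apply_eq_iff_eq])

theorem degree_valencies (Γ : ClosedGraph) : Γ.valencies.degree = Γ.numV :=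
  degree_eq_of_sum_single _ _ rfl

theorem halfEdges_valencies (Γ : ClosedGraph) : halfEdges Γ.valencies = Γ.numH := by
  classical
  rw [halfEdges_eq_of_sum_single _ _ Γ.sum_single_arity]
  show ∑ a, Fintype.card (Γ.Star a) = Γ.numH
  rw [← Fintype.card_sigma, Fintype.card_congr (Equiv.sigmaFiberEquiv Γ.vert), Fintype.card_fin]

section Value

variable {V : Type*} [NormedAddCommGroup V] [InnerProductSpace ℝ V]
  {R : Type*} [CommRing R] [Algebra ℂ R] {ι : Type*} [Fintype ι]

/-- Each vertex contributes its own scalar independently of the colouring. The general algebra `R`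
serves both the formal variables and the numerical x. -/
theorem value_scale (b : OrthonormalBasis ι ℝ V) (S : SymmetricTensors V ℂ) (x : ℕ+ → R)
    (Γ : ClosedGraph) :
    Γ.value b (S.scale x) =
      (Γ.valencies.prod fun k j => x k ^ j) * algebraMap ℂ R (Γ.value b S) := by
  classical
  unfold value
  rw [map_sum, Finset.mul_sum]
  refine Finset.sum_congr rfl fun c _ => ?_
  rw [map_prod, ← prod_eq_prod_of_sum_single x _ _ Γ.sum_single_arity, ← Finset.prod_mul_distrib]
  rfl

end Value

instance (Γ Γ' : ClosedGraph) : Finite (Iso Γ Γ') :=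
  Finite.of_injective
    (fun e : Iso Γ Γ' => ((e.onV, e.onH) : (Fin Γ.numV ≃ Fin Γ'.numV) × (Fin Γ.numH ≃ Fin Γ'.numH)))
    fun _ _ h => Iso.ext' (congrArg Prod.fst h) (congrArg Prod.snd h)

theorem autCard_pos (Γ : ClosedGraph) : 0 < Γ.autCard :=
  have : Nonempty (Iso Γ Γ) := ⟨Iso.refl Γ⟩
  Nat.card_pos

/-- Isomorphisms onto an isomorphic graph form a torsor under the automorphism group. -/
theorem card_iso {Γ Γ' : ClosedGraph} (e : Iso Γ Γ') : Nat.card (Iso Γ Γ') = Γ.autCard :=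
  Nat.card_congr
    { toFun := fun s => s.trans e.symm
      invFun := fun s => s.trans e
      left_inv := fun s => by
        apply Iso.ext' <;> ext h <;> simp [Iso.trans, Iso.symm]
      right_inv := fun s => by
        apply Iso.ext' <;> ext h <;> simp [Iso.trans, Iso.symm] }

end ClosedGraph

/-! ### Labelled graphs and the factor 1/|Aut Γ|. -/

/-- Graph structures with vertex set `Fin n` and set of half-edges `Fin m`. -/
abbrev LabelledGraph (n m : ℕ) : Type :=
  {f : Fin m → Fin n // Function.Surjective f} × {o : Fin m → Fin m // IsPairing o}

namespace LabelledGraph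

/-- The closed graph underlying a labelled graph. -/
def toGraph {n m : ℕ} (p : LabelledGraph n m) : ClosedGraph where
  numV := n
  numH := m
  vert := p.1.1
  opp := p.2.1
  vert_surjective := p.1.2
  opp_opp := p.2.2.1
  opp_ne := p.2.2.2

/-- Transporting the structure of a graph along permutations of vertices and half-edges. -/
def transport {Γ : ClosedGraph} (σ : Equiv.Perm (Fin Γ.numV)) (τ : Equiv.Perm (Fin Γ.numH)) :
    Σ p : LabelledGraph Γ.numV Γ.numH, ClosedGraph.Iso Γ p.toGraph :=
  ⟨(⟨fun h => σ (Γ.vert (τ.symm h)),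
      σ.surjective.comp (Γ.vert_surjective.comp τ.symm.surjective)⟩,
    ⟨fun h => τ (Γ.opp (τ.symm h)), fun h => by simp [Γ.opp_opp], fun h e => by
      rw [← Equiv.eq_symm_apply] at e
      exact Γ.opp_ne _ e⟩),
    { onV := σ
      onH := τ
      map_vert := fun h => congrArg (fun h => σ (Γ.vert h)) (τ.symm_apply_apply h)
      map_opp := fun h => congrArg (fun h => τ (Γ.opp h)) (τ.symm_apply_apply h) }⟩

theorem transport_eq {Γ : ClosedGraph} (σ : Equiv.Perm (Fin Γ.numV)) (τ : Equiv.Perm (Fin Γ.numH))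
    (p : LabelledGraph Γ.numV Γ.numH) (hv : ∀ h, p.1.1 (τ h) = σ (Γ.vert h))
    (ho : ∀ h, p.2.1 (τ h) = τ (Γ.opp h)) :
    transport σ τ = ⟨p, ⟨σ, τ, hv, ho⟩⟩ := by
  obtain ⟨⟨f, hf⟩, ⟨o, hp⟩⟩ := p
  obtain rfl : (fun h => σ (Γ.vert (τ.symm h))) = f := by
    funext h
    simpa using (hv (τ.symm h)).symm
  obtain rfl : (fun h => τ (Γ.opp (τ.symm h))) = o := by
    funext h
    simpa using (ho (τ.symm h)).symm
  rfl

/-- A graph structure with an isomorphism from `Γ` amounts to a relabelling of `Γ`. -/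
def transportEquiv (Γ : ClosedGraph) :
    (Σ p : LabelledGraph Γ.numV Γ.numH, ClosedGraph.Iso Γ p.toGraph) ≃
      Equiv.Perm (Fin Γ.numV) × Equiv.Perm (Fin Γ.numH) where
  toFun q := (q.2.onV, q.2.onH)
  invFun s := transport s.1 s.2
  left_inv q := transport_eq _ _ q.1 q.2.map_vert q.2.map_opp
  right_inv _ := rfl

open Classical in
-- Orbit-stabilizer, by counting pairs of a labelled structure and an isomorphism from Γ to it. Such
-- a pair is determined by arbitrary permutations of vertices and half-edges; conversely each
-- structure isomorphic to Γ occurs |Aut Γ| times.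
theorem card_isomorphic_mul_autCard (Γ : ClosedGraph) :
    (Finset.univ.filter fun p : LabelledGraph Γ.numV Γ.numH =>
      Nonempty (ClosedGraph.Iso Γ p.toGraph)).card * Γ.autCard =
      Γ.numV.factorial * Γ.numH.factorial := by
  have h := Nat.card_congr (transportEquiv Γ)
  rw [Nat.card_sigma, Nat.card_prod, Nat.card_perm, Nat.card_perm, Nat.card_fin, Nat.card_fin] at h
  rw [← h, Finset.card_filter, Finset.sum_mul]
  refine Finset.sum_congr rfl fun p _ => ?_
  split_ifs with hp
  · rw [one_mul, ClosedGraph.card_iso hp.some]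
  · rw [not_nonempty_iff] at hp
    rw [zero_mul, Nat.card_of_isEmpty]

end LabelledGraph

/-! ### Sums over isomorphism classes as sums over labelled graphs. -/

namespace GraphClass

/-- The isomorphism class of a graph. -/
def mk (Γ : ClosedGraph) : GraphClass := Quotient.mk _ Γ

theorem mk_eq_mk {Γ Γ' : ClosedGraph} : mk Γ = mk Γ' ↔ Nonempty (ClosedGraph.Iso Γ Γ') :=
  Quotient.eq

theorem exists_mk (γ : GraphClass) : ∃ Γ, mk Γ = γ := Quotient.exists_rep γ

/-- The number of vertices of each valency. -/
noncomputable def valencies : GraphClass → ℕ+ →₀ ℕ :=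
  Quotient.lift ClosedGraph.valencies fun _ _ ⟨e⟩ => e.valencies_eq

theorem halfEdges_valencies (γ : GraphClass) : halfEdges γ.valencies = γ.numH := by
  obtain ⟨Γ, rfl⟩ := γ.exists_mk
  exact ClosedGraph.halfEdges_valencies _

variable {V : Type*} [NormedAddCommGroup V] [InnerProductSpace ℝ V]
  {R : Type*} [CommRing R] [Algebra ℂ R] {ι : Type*} [Fintype ι]

theorem term_scale (b : OrthonormalBasis ι ℝ V) (S : SymmetricTensors V ℂ) (x : ℕ+ → R)
    (γ : GraphClass) :
    γ.term b (S.scale x) =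
      (γ.valencies.prod fun k j => x k ^ j) * algebraMap ℂ R (γ.term b S) := by
  obtain ⟨Γ, rfl⟩ := γ.exists_mk
  show (Γ.autCard : ℂ)⁻¹ • Γ.value b (S.scale x) =
    (Γ.valencies.prod fun k j => x k ^ j) * algebraMap ℂ R ((Γ.autCard : ℂ)⁻¹ • Γ.value b S)
  rw [ClosedGraph.value_scale, Algebra.smul_def, smul_eq_mul, map_mul]
  ring

open Classical in
-- The class has n! m! / |Aut Γ| labelled representatives, all with the same value, so clearing the
-- factorials removes the automorphism group.
theorem term_mul_factorial (b : OrthonormalBasis ι ℝ V) (S : SymmetricTensors V ℂ) {n m : ℕ}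
    (γ : GraphClass) (hn : γ.valencies.degree = n) (hm : halfEdges γ.valencies = m) :
    γ.term b S * (n.factorial * m.factorial) =
      ∑ p : LabelledGraph n m,
        if mk p.toGraph = γ then p.toGraph.value b S else 0 := by
  obtain ⟨Γ, rfl⟩ := γ.exists_mk
  obtain rfl : Γ.numV = n := Γ.degree_valencies.symm.trans hn
  obtain rfl : Γ.numH = m := Γ.halfEdges_valencies.symm.trans hm
  have h1 : ∀ p : LabelledGraph Γ.numV Γ.numH,
      (if mk p.toGraph = mk Γ then p.toGraph.value b S else 0) =
      if Nonempty (ClosedGraph.Iso Γ p.toGraph) then Γ.value b S else 0 := by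
    intro p
    have h2 : mk p.toGraph = mk Γ ↔
        Nonempty (ClosedGraph.Iso Γ p.toGraph) :=
      eq_comm.trans mk_eq_mk
    by_cases hp : Nonempty (ClosedGraph.Iso Γ p.toGraph)
    · rw [if_pos (h2.mpr hp), if_pos hp, ClosedGraph.value_eq_of_iso b S hp.some]
    · rw [if_neg (mt h2.mp hp), if_neg hp]
  rw [Finset.sum_congr rfl fun p _ => h1 p, ← Finset.sum_filter, Finset.sum_const, nsmul_eq_mul]
  have h3 := LabelledGraph.card_isomorphic_mul_autCard Γ
  have h4 : (Γ.autCard : ℂ) ≠ 0 := by exact_mod_cast Γ.autCard_pos.ne'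
  show (Γ.autCard : ℂ)⁻¹ * Γ.value b S * _ = _
  rw [← Nat.cast_mul, ← h3]
  push_cast
  field_simp

open Classical in
theorem sum_term_mul_factorial (b : OrthonormalBasis ι ℝ V) (S : SymmetricTensors V ℂ)
    (d : ℕ+ →₀ ℕ) (F : Finset GraphClass) (hF : ∀ γ, γ ∈ F ↔ γ.valencies = d) :
    (∑ γ ∈ F, γ.term b S) * (d.degree.factorial * (halfEdges d).factorial) =
      ∑ p : LabelledGraph d.degree (halfEdges d),
        if fiberSizes p.1.1 = d then p.toGraph.value b S else 0 := by
  rw [Finset.sum_mul, Finset.sum_congr rfl fun γ hγ => term_mul_factorial b S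
    (n := d.degree) (m := halfEdges d) γ (by rw [(hF γ).mp hγ]) (by rw [(hF γ).mp hγ]),
    Finset.sum_comm]
  refine Finset.sum_congr rfl fun p _ => ?_
  rw [Finset.sum_ite_eq]
  exact if_congr (hF _) rfl rfl

end GraphClass

/-! ### Gaussian integrals of vertex products as sums over graphs. -/

section Wick

open MeasureTheory

variable {V : Type*} [NormedAddCommGroup V] [InnerProductSpace ℝ V] {ι : Type*} [Fintype ι]

theorem SymmetricTensors.eval_const (S : SymmetricTensors V ℂ) {κ : Type*} [Fintype κ] [Nonempty κ]
    (v : V) :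
    S.eval (fun _ : κ => (1 : ℂ) ⊗ₜ[ℝ] v) = S.diag (SymmetricTensors.arity κ) v := rfl

theorem SymmetricTensors.eval_const_eq_sum (b : OrthonormalBasis ι ℝ V) (S : SymmetricTensors V ℂ)
    {κ : Type*} [Fintype κ] [DecidableEq κ] [Nonempty κ] (v : V) :
    S.eval (fun _ : κ => (1 : ℂ) ⊗ₜ[ℝ] v) =
      ∑ c : κ → ι, (∏ h, ((inner ℝ (b (c h)) v : ℝ) : ℂ)) *
        S.eval fun h => (1 : ℂ) ⊗ₜ[ℝ] b (c h) := by
  classical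
  have h1 : (1 : ℂ) ⊗ₜ[ℝ] v =
      ∑ i, ((inner ℝ (b i) v : ℝ) : ℂ) • ((1 : ℂ) ⊗ₜ[ℝ] b i) := by
    conv_lhs => rw [← b.sum_repr' v]
    rw [TensorProduct.tmul_sum]
    refine Finset.sum_congr rfl fun i _ => ?_
    rw [TensorProduct.tmul_smul, TensorProduct.smul_tmul', TensorProduct.smul_tmul',
      Complex.real_smul, smul_eq_mul]
  unfold SymmetricTensors.eval
  simp_rw [h1]
  rw [MultilinearMap.map_sum]
  refine Fintype.sum_equiv ((SymmetricTensors.enum κ).arrowCongr (Equiv.refl ι)).symm _ _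
    fun c => ?_
  rw [MultilinearMap.map_smul_univ, smul_eq_mul]
  congr 1
  · exact (Fintype.prod_equiv (SymmetricTensors.enum κ) _ _ fun h => rfl).symm
  · simp

/-- A colouring is a family of colourings of the fibres of a map. -/
def coloringEquivPi {m n : ℕ} (f : Fin m → Fin n) (ι : Type*) :
    (Fin m → ι) ≃ ∀ a, {h // f h = a} → ι where
  toFun c _ h := c h.1
  invFun C h := C (f h) ⟨h, rfl⟩
  left_inv _ := rfl
  right_inv C := by
    funext a ⟨h, e⟩
    subst e
    rfl

open Classical in
-- Each vertex factor is a sum over colourings of its own half-edges; distributing the product gives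
-- a sum over colourings of all half-edges, not yet matched into edges.
theorem prod_diag_eq_sum (b : OrthonormalBasis ι ℝ V) (S : SymmetricTensors V ℂ) {n m : ℕ}
    (f : {f : Fin m → Fin n // Function.Surjective f}) [∀ a, Nonempty {h // f.1 h = a}] (v : V) :
    ((fiberSizes f.1).prod fun k j => S.diag k v ^ j) =
      ∑ c : Fin m → ι, ((∏ h, inner ℝ (b (c h)) v : ℝ) : ℂ) *
        ∏ a, S.eval fun h : {h // f.1 h = a} => (1 : ℂ) ⊗ₜ[ℝ] b (c h.1) := by
  rw [← prod_eq_prod_of_sum_single (fun k => S.diag k v)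
    (fun a => (Nat.card {h // f.1 h = a}).toPNat') (fiberSizes f.1) rfl]
  have h1 : ∀ a, S.diag (Nat.card {h // f.1 h = a}).toPNat' v =
      ∑ c : {h // f.1 h = a} → ι, (∏ h, ((inner ℝ (b (c h)) v : ℝ) : ℂ)) *
        S.eval fun h => (1 : ℂ) ⊗ₜ[ℝ] b (c h) := by
    intro a
    rw [SymmetricTensors.toPNat'_natCard, ← SymmetricTensors.eval_const,
      SymmetricTensors.eval_const_eq_sum b]
  rw [Finset.prod_congr rfl fun a _ => h1 a, Finset.prod_univ_sum, Fintype.piFinset_univ]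
  refine (Fintype.sum_equiv (coloringEquivPi f.1 ι) _ _ fun c => ?_).symm
  rw [Finset.prod_mul_distrib, Complex.ofReal_prod]
  congr 1
  exact (Fintype.prod_fiberwise f.1 fun h => ((inner ℝ (b (c h)) v : ℝ) : ℂ)).symm

theorem coeff_formalIntegrand (S : SymmetricTensors V ℂ) (d : ℕ+ →₀ ℕ) (v : V) :
    MvPowerSeries.coeff d (formalIntegrand S v) =
      (d.prod fun k j => S.diag k v ^ j) / ((d.prod fun _ j => (j.factorial : ℂ)) *
        d.prod fun k j => ((k : ℕ).factorial : ℂ) ^ j) := by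
  rw [formalIntegrand, coeff_exp_subst_linearSeries]
  simp_rw [div_pow]
  rw [mul_comm, ← div_div]
  congr 1
  exact Finset.prod_div_distrib ..

variable [FiniteDimensional ℝ V] [MeasurableSpace V] [BorelSpace V]

theorem integrable_prod_diag (b : OrthonormalBasis ι ℝ V) (S : SymmetricTensors V ℂ) {n m : ℕ}
    (f : {f : Fin m → Fin n // Function.Surjective f}) :
    Integrable (fun v => (fiberSizes f.1).prod fun k j => S.diag k v ^ j) (feynmanGaussian V) := by
  classical
  have : ∀ a, Nonempty {h // f.1 h = a} := fun a => let ⟨h, e⟩ := f.2 a; ⟨⟨h, e⟩⟩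
  simp_rw [prod_diag_eq_sum b S f]
  exact integrable_finsetSum _ fun c _ => (integrable_prod_coord b c).ofReal.mul_const _

/-- Double counting of compatible pairs of a colouring and a pairing: for a fixed colouring Wick's
theorem counts the pairings, while for a fixed pairing the colourings constant on edges are those of
the contraction with Casimir elements. -/
theorem sum_value_eq_integral (b : OrthonormalBasis ι ℝ V) (S : SymmetricTensors V ℂ) {n m : ℕ}
    (f : {f : Fin m → Fin n // Function.Surjective f}) [Fintype {o : Fin m → Fin m // IsPairing o}] :
    ∑ o : {o : Fin m → Fin m // IsPairing o}, (LabelledGraph.toGraph (f, o)).value b S =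
      ∫ v, (fiberSizes f.1).prod (fun k j => S.diag k v ^ j) ∂(feynmanGaussian V) := by
  classical
  have : ∀ a, Nonempty {h // f.1 h = a} := fun a => let ⟨h, e⟩ := f.2 a; ⟨⟨h, e⟩⟩
  simp_rw [prod_diag_eq_sum b S f]
  rw [integral_finsetSum _ fun c _ => (integrable_prod_coord b c).ofReal.mul_const _]
  have h1 : ∀ c : Fin m → ι, ∫ v, ((∏ h, inner ℝ (b (c h)) v : ℝ) : ℂ) *
        (∏ a, S.eval fun h : {h // f.1 h = a} => (1 : ℂ) ⊗ₜ[ℝ] b (c h.1)) ∂(feynmanGaussian V) =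
      ∑ o : {o : Fin m → Fin m // IsPairing o}, if ∀ h, c (o.1 h) = c h then
        (∏ a, S.eval fun h : {h // f.1 h = a} => (1 : ℂ) ⊗ₜ[ℝ] b (c h.1)) else 0 := by
    intro c
    rw [integral_mul_const, integral_complex_ofReal, integral_prod_coord, ← Finset.sum_filter,
      Finset.sum_const, nsmul_eq_mul]
    congr 1
    rw [Complex.ofReal_natCast, ← Fintype.card_subtype, ← Nat.card_eq_fintype_card]
    congr 1
    exact Nat.card_congr (Equiv.subtypeSubtypeEquivSubtypeInter _ _).symm
  rw [Finset.sum_congr rfl fun c _ => h1 c, Finset.sum_comm]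
  refine Finset.sum_congr rfl fun o _ => ?_
  rw [← Finset.sum_filter]
  unfold ClosedGraph.value
  rw [Finset.sum_subtype (p := fun c : Fin m → ι => ∀ h, c (o.1 h) = c h) (F := inferInstance)
    (Finset.univ.filter fun c : Fin m → ι => ∀ h, c (o.1 h) = c h) (by simp)]
  exact Fintype.sum_equiv (Equiv.refl _) _ _ fun c => rfl

/-- The count in `card_fiberSizes` cannot vanish, since n! m! does not. Hence every monomial in the
S_k comes from a map, which gives its integrability. -/
theorem exists_fiberSizes_eq (d : ℕ+ →₀ ℕ) :
    ∃ f : {f : Fin (halfEdges d) → Fin d.degree // Function.Surjective f}, fiberSizes f.1 = d := by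
  by_contra h
  have h1 : IsEmpty {f : Fin (halfEdges d) → Fin d.degree //
      Function.Surjective f ∧ fiberSizes f = d} :=
    ⟨fun f => h ⟨⟨f.1, f.2.1⟩, f.2.2⟩⟩
  have h2 := card_fiberSizes d
  rw [Nat.card_of_isEmpty, Nat.cast_zero, zero_mul, eq_comm] at h2
  exact mul_ne_zero (Nat.cast_ne_zero.mpr (Nat.factorial_ne_zero _))
    (Nat.cast_ne_zero.mpr (Nat.factorial_ne_zero _)) h2

theorem integrable_coeff_formalIntegrand (S : SymmetricTensors V ℂ) (d : ℕ+ →₀ ℕ) :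
    Integrable (fun v => MvPowerSeries.coeff d (formalIntegrand S v)) (feynmanGaussian V) := by
  simp_rw [coeff_formalIntegrand]
  obtain ⟨f, hf⟩ := exists_fiberSizes_eq d
  have h := integrable_prod_diag (stdOrthonormalBasis ℝ V) S f
  rw [hf] at h
  exact h.div_const _

/-- The graphs with prescribed numbers of vertices of each valency contribute the coefficient
of the formal partition function. -/
theorem sum_term_eq_integral (b : OrthonormalBasis ι ℝ V) (S : SymmetricTensors V ℂ)
    (d : ℕ+ →₀ ℕ) (F : Finset GraphClass) (hF : ∀ γ, γ ∈ F ↔ γ.valencies = d) :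
    ∑ γ ∈ F, γ.term b S =
      ∫ v, MvPowerSeries.coeff d (formalIntegrand S v) ∂(feynmanGaussian V) := by
  classical
  simp_rw [coeff_formalIntegrand]
  rw [integral_div]
  have hpos : ((d.degree.factorial : ℂ) * (halfEdges d).factorial) ≠ 0 :=
    mul_ne_zero (Nat.cast_ne_zero.mpr (Nat.factorial_ne_zero _))
      (Nat.cast_ne_zero.mpr (Nat.factorial_ne_zero _))
  have hcard := card_fiberSizes d
  have hne : ((d.prod fun _ j => (j.factorial : ℂ)) *
      d.prod fun k j => ((k : ℕ).factorial : ℂ) ^ j) ≠ 0 := by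
    intro h
    rw [h, mul_zero] at hcard
    exact hpos hcard.symm
  have hsum : ∑ p : LabelledGraph d.degree (halfEdges d),
        (if fiberSizes p.1.1 = d then p.toGraph.value b S else 0) =
      Nat.card {f : Fin (halfEdges d) → Fin d.degree //
        Function.Surjective f ∧ fiberSizes f = d} *
        ∫ v, (d.prod fun k j => S.diag k v ^ j) ∂(feynmanGaussian V) := by
    rw [Fintype.sum_prod_type]
    have h1 : ∀ f : {f : Fin (halfEdges d) → Fin d.degree // Function.Surjective f},
        (∑ o : {o : Fin (halfEdges d) → Fin (halfEdges d) // IsPairing o},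
          if fiberSizes f.1 = d then (LabelledGraph.toGraph (f, o)).value b S else 0) =
        if fiberSizes f.1 = d then
          ∫ v, (d.prod fun k j => S.diag k v ^ j) ∂(feynmanGaussian V) else 0 := by
      intro f
      split_ifs with hf
      · rw [sum_value_eq_integral, hf]
      · exact Finset.sum_const_zero
    rw [Finset.sum_congr rfl fun f _ => h1 f, ← Finset.sum_filter, Finset.sum_const, nsmul_eq_mul,
      ← Fintype.card_subtype, ← Nat.card_eq_fintype_card]
    congr 2
    exact Nat.card_congr (Equiv.subtypeSubtypeEquivSubtypeInter Function.Surjective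
      fun f : Fin (halfEdges d) → Fin d.degree => fiberSizes f = d)
  rw [eq_div_iff hne]
  -- Multiplying by n! m! makes the left side a sum over labelled graphs; `card_fiberSizes` rewrites
  -- the same factor on the right.
  refine mul_right_cancel₀ hpos ?_
  rw [mul_right_comm, GraphClass.sum_term_mul_factorial b S d F hF, hsum, ← hcard]
  ring

end Wick

/-! ### The formal identity and its truncation. -/

section FormalIdentity

theorem GraphClass.mem_upTo {M : ℕ} {γ : GraphClass} : γ ∈ GraphClass.upTo M ↔ γ.numH ≤ M := by
  simp [GraphClass.upTo]

variable {V : Type*} [NormedAddCommGroup V] [InnerProductSpace ℝ V]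
    [FiniteDimensional ℝ V] [MeasurableSpace V] [BorelSpace V] {ι : Type*} [Fintype ι]

open Classical in
theorem sum_upTo_filter_eq_integral (b : OrthonormalBasis ι ℝ V) (S : SymmetricTensors V ℂ)
    (d : ℕ+ →₀ ℕ) {M : ℕ} (hd : halfEdges d ≤ M) :
    ∑ γ ∈ (GraphClass.upTo M).filter (fun γ => γ.valencies = d), γ.term b S =
      ∫ v, MvPowerSeries.coeff d (formalIntegrand S v) ∂(feynmanGaussian V) := by
  refine sum_term_eq_integral b S d _ fun γ => ?_
  rw [Finset.mem_filter, GraphClass.mem_upTo, and_iff_right_iff_imp]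
  rintro rfl
  rwa [← GraphClass.halfEdges_valencies]

/-- Every graph contributes to a single monomial, and a monomial fixes the number of half-edges, so
each coefficient is a finite sum. -/
theorem hasSum_term_formalPartition (b : OrthonormalBasis ι ℝ V) (S : SymmetricTensors V ℂ) :
    HasSum (GraphClass.term b (S.scale fun k => (MvPowerSeries.X k : MvPowerSeries ℕ+ ℂ)))
        (formalPartition S) := by
  classical
  rw [MvPowerSeries.WithPiTopology.hasSum_iff_hasSum_coeff]
  intro d
  have h1 : ∀ γ : GraphClass, MvPowerSeries.coeff d
      (γ.term b (S.scale fun k => (MvPowerSeries.X k : MvPowerSeries ℕ+ ℂ))) =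
      if γ.valencies = d then γ.term b S else 0 := by
    intro γ
    rw [GraphClass.term_scale, ← MvPowerSeries.monomial_one_eq, MvPowerSeries.algebraMap_apply,
      MvPowerSeries.coeff_mul_C, MvPowerSeries.coeff_monomial, ite_mul, one_mul, zero_mul]
    exact if_congr eq_comm rfl rfl
  simp_rw [h1]
  have h2 : MvPowerSeries.coeff d (formalPartition S) = _ :=
    (sum_upTo_filter_eq_integral b S d le_rfl).symm
  rw [h2, Finset.sum_filter]
  refine hasSum_sum_of_ne_finset_zero fun γ hγ => if_neg ?_
  rintro rfl
  exact hγ (GraphClass.mem_upTo.mpr (GraphClass.halfEdges_valencies γ).ge)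

theorem sum_upTo_term_scale (b : OrthonormalBasis ι ℝ V) (S : SymmetricTensors V ℂ) (x : ℕ+ → ℂ)
    (M : ℕ) (D : Finset (ℕ+ →₀ ℕ)) (hD : ∀ d, d ∈ D ↔ halfEdges d ≤ M) :
    ∑ γ ∈ GraphClass.upTo M, γ.term b (S.scale x) =
      ∫ v, ∑ d ∈ D, (d.prod fun k j => x k ^ j) * MvPowerSeries.coeff d (formalIntegrand S v)
        ∂(feynmanGaussian V) := by
  classical
  rw [MeasureTheory.integral_finsetSum _ fun d _ =>
    (integrable_coeff_formalIntegrand S d).const_mul _,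
    ← Finset.sum_fiberwise_of_maps_to (g := GraphClass.valencies) (t := D) fun γ hγ => by
      rw [hD, GraphClass.halfEdges_valencies]; exact GraphClass.mem_upTo.mp hγ]
  refine Finset.sum_congr rfl fun d hd => ?_
  rw [MeasureTheory.integral_const_mul, ← sum_upTo_filter_eq_integral b S d ((hD d).mp hd),
    Finset.mul_sum]
  refine Finset.sum_congr rfl fun γ hγ => ?_
  rw [GraphClass.term_scale, (Finset.mem_filter.mp hγ).2]
  rfl

end FormalIdentity

/-! ### Pointwise remainder estimate for the exponential. -/

section PointwiseEstimate

/-- The usual remainder bound involves exp ‖z‖, which need not be integrable; here only ‖exp z‖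
appears. For ‖z‖ ≤ 1 one has exp ‖z‖ ≤ 3, and for ‖z‖ ≥ 1 each of the n Taylor terms, and 1, is at
most ‖z‖^n. -/
theorem norm_exp_sub_sum_le_pow_mul (z : ℂ) (n : ℕ) :
    ‖Complex.exp z - ∑ m ∈ Finset.range n, z ^ m / m.factorial‖ ≤
      ‖z‖ ^ n * (n + 3 + ‖Complex.exp z‖) := by
  rcases le_total ‖z‖ 1 with h | h
  · refine (Complex.norm_exp_sub_sum_le_norm_mul_exp z n).trans ?_
    gcongr
    have h1 : Real.exp ‖z‖ ≤ 3 :=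
      (Real.exp_le_exp.mpr h).trans (Real.exp_one_lt_d9.le.trans (by norm_num))
    have : (0 : ℝ) ≤ n := Nat.cast_nonneg n
    linarith [norm_nonneg (Complex.exp z)]
  · have h1 : ∀ m ∈ Finset.range n, ‖z ^ m / m.factorial‖ ≤ ‖z‖ ^ n := by
      intro m hm
      rw [norm_div, norm_pow, Complex.norm_natCast]
      exact (div_le_self (by positivity) (by exact_mod_cast m.factorial_pos)).trans
        (pow_le_pow_right₀ h (Finset.mem_range.mp hm).le)
    have h2 : ‖∑ m ∈ Finset.range n, z ^ m / m.factorial‖ ≤ n * ‖z‖ ^ n := by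
      refine (norm_sum_le_of_le _ h1).trans ?_
      simp
    have h3 : (1 : ℝ) ≤ ‖z‖ ^ n := one_le_pow₀ h
    refine (norm_sub_le _ _).trans ?_
    nlinarith [norm_nonneg (Complex.exp z)]

theorem norm_pow_sub_pow_le {z w : ℂ} {G δ : ℝ} (hz : ‖z‖ ≤ G) (hw : ‖w‖ ≤ G)
    (hzw : ‖z - w‖ ≤ δ * G) (n : ℕ) : ‖z ^ n - w ^ n‖ ≤ δ * (n * G ^ n) := by
  have hG : 0 ≤ G := (norm_nonneg z).trans hz
  induction n with
  | zero => simp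
  | succ n ih =>
    calc ‖z ^ (n + 1) - w ^ (n + 1)‖ = ‖z * (z ^ n - w ^ n) + (z - w) * w ^ n‖ := by
          congr 1; ring
      _ ≤ G * (δ * (n * G ^ n)) + δ * G * G ^ n := by
          refine (norm_add_le _ _).trans ?_
          rw [norm_mul, norm_mul, norm_pow]
          have hδ : 0 ≤ δ * G := (norm_nonneg _).trans hzw
          gcongr
      _ = δ * ((n + 1 : ℕ) * G ^ (n + 1)) := by push_cast; ring

theorem sum_pow_div_factorial {α K : Type*} [DecidableEq α] [Field K] [CharZero K] (s : Finset α)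
    (c : α → K) (n : ℕ) :
    (∑ k ∈ s, c k) ^ n / n.factorial =
      ∑ d ∈ s.finsuppAntidiag n,
        (d.prod fun k j => c k ^ j) / (d.prod fun _ j => (j.factorial : K)) := by
  rw [Finset.sum_pow_eq_sum_piAntidiag, Finset.sum_div]
  symm
  refine Finset.sum_bij (fun d _ => ⇑d) (fun d hd => ?_) (fun _ _ _ _ h => DFunLike.coe_injective h)
    (fun f hf => ?_) (fun d hd => ?_)
  · rw [Finset.mem_finsuppAntidiag] at hd
    rw [Finset.mem_piAntidiag]
    exact ⟨hd.1, fun i hi => hd.2 (Finsupp.mem_support_iff.mpr hi)⟩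
  · rw [Finset.mem_piAntidiag] at hf
    refine ⟨Finsupp.onFinset s f hf.2, ?_, rfl⟩
    rw [Finset.mem_finsuppAntidiag]
    exact ⟨hf.1, Finsupp.support_onFinset_subset⟩
  · rw [Finset.mem_finsuppAntidiag] at hd
    rw [Finsupp.prod_of_support_subset d hd.2 _ (by simp),
      Finsupp.prod_of_support_subset d hd.2 _ (by simp)]
    have h := Nat.multinomial_spec s d
    rw [hd.1] at h
    have h0 : (∏ i ∈ s, ((d i).factorial : K)) ≠ 0 :=
      Finset.prod_ne_zero_iff.mpr fun i _ => Nat.cast_ne_zero.mpr (Nat.factorial_ne_zero _)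
    have h1 : (Nat.multinomial s d : K) ≠ 0 := Nat.cast_ne_zero.mpr (Nat.multinomial_pos s d).ne'
    rw [← h]
    push_cast
    field_simp

/-- The indices of the variables of weight at most `M`. -/
def lowValencies (M : ℕ) : Finset ℕ+ := (Finset.range M).image Nat.succPNat

theorem mem_lowValencies {M : ℕ} {k : ℕ+} : k ∈ lowValencies M ↔ (k : ℕ) ≤ M := by
  rw [lowValencies, Finset.mem_image]
  constructor
  · rintro ⟨n, hn, rfl⟩
    exact Finset.mem_range.mp hn
  · intro h
    refine ⟨k.natPred, Finset.mem_range.mpr ?_, k.succPNat_natPred⟩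
    have := k.natPred_add_one
    omega

/-- The exponents of degree at most `M` in the variables of weight at most `M`. -/
noncomputable def lowExponents (M : ℕ) : Finset (ℕ+ →₀ ℕ) :=
  (Finset.range (M + 1)).biUnion fun n => (lowValencies M).finsuppAntidiag n

theorem sum_lowExponents {K : Type*} [Field K] [CharZero K] (M : ℕ) (c : ℕ+ → K) :
    ∑ d ∈ lowExponents M, (d.prod fun k j => c k ^ j) / (d.prod fun _ j => (j.factorial : K)) =
      ∑ n ∈ Finset.range (M + 1), (∑ k ∈ lowValencies M, c k) ^ n / n.factorial := by
  rw [lowExponents, Finset.sum_biUnion]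
  · exact Finset.sum_congr rfl fun n _ => (sum_pow_div_factorial _ _ _).symm
  · intro n _ n' _ hne
    rw [Function.onFun, Finset.disjoint_left]
    intro d hd hd'
    rw [Finset.mem_finsuppAntidiag] at hd hd'
    exact hne (hd.1.symm.trans hd'.1)

theorem mem_lowExponents_of_halfEdges_le {M : ℕ} {d : ℕ+ →₀ ℕ} (hd : halfEdges d ≤ M) :
    d ∈ lowExponents M := by
  have hsupp : d.support ⊆ lowValencies M := by
    intro k hk
    rw [mem_lowValencies]
    refine le_trans ?_ hd
    refine le_trans ?_ (Finset.single_le_sum (f := fun k : ℕ+ => (k : ℕ) * d k)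
      (fun _ _ => Nat.zero_le _) hk)
    exact Nat.le_mul_of_pos_right _ (Nat.pos_of_ne_zero (Finsupp.mem_support_iff.mp hk))
  have hdeg : d.degree ≤ M := by
    refine le_trans ?_ hd
    rw [Finsupp.degree_apply]
    exact Finset.sum_le_sum fun k _ => Nat.le_mul_of_pos_left _ k.pos
  rw [lowExponents, Finset.mem_biUnion]
  refine ⟨d.degree, Finset.mem_range.mpr (by omega), ?_⟩
  rw [Finset.mem_finsuppAntidiag]
  refine ⟨?_, hsupp⟩
  rw [Finsupp.degree_apply]
  exact (Finset.sum_subset hsupp fun k _ hk => Finsupp.notMem_support_iff.mp hk).symm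

/-- The exponents of weight at most `M`. -/
noncomputable def weightLE (M : ℕ) : Finset (ℕ+ →₀ ℕ) :=
  (lowExponents M).filter fun d => halfEdges d ≤ M

theorem mem_weightLE {M : ℕ} {d : ℕ+ →₀ ℕ} : d ∈ weightLE M ↔ halfEdges d ≤ M := by
  rw [weightLE, Finset.mem_filter, and_iff_right_iff_imp]
  exact mem_lowExponents_of_halfEdges_le

theorem norm_prod_pow_le {c : ℕ+ → ℂ} {ρ : ℕ+ → ℝ} {ε : ℝ} (hc : ∀ k, ‖c k‖ ≤ ρ k * ε ^ (k : ℕ))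
    (d : ℕ+ →₀ ℕ) :
    ‖d.prod fun k j => c k ^ j‖ ≤ (d.prod fun k j => ρ k ^ j) * ε ^ halfEdges d := by
  rw [halfEdges, Finsupp.sum, ← Finset.prod_pow_eq_pow_sum, Finsupp.prod, Finsupp.prod,
    ← Finset.prod_mul_distrib, norm_prod]
  refine Finset.prod_le_prod (fun _ _ => norm_nonneg _) fun k _ => ?_
  rw [norm_pow, pow_mul, ← mul_pow]
  exact pow_le_pow_left₀ (norm_nonneg _) (hc k) _

/-- The exponential of a sum of terms of weights `1, 2, …` agrees with its part of weight at most
`M` up to order `M + 1`. -/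
theorem norm_exp_tsum_sub_sum_weightLE_le {c : ℕ+ → ℂ} {ρ : ℕ+ → ℝ} {ε : ℝ} (hρ : ∀ k, 0 ≤ ρ k)
    (hsum : Summable ρ) (hε : 0 < ε) (hε1 : ε ≤ 1) (hc : ∀ k, ‖c k‖ ≤ ρ k * ε ^ (k : ℕ)) (M : ℕ) :
    ‖Complex.exp (∑' k, c k) - ∑ d ∈ weightLE M,
        (d.prod fun k j => c k ^ j) / (d.prod fun _ j => (j.factorial : ℂ))‖ ≤
      ε ^ (M + 1) * ((∑' k, ρ k) ^ (M + 1) * (M + 4 + ‖Complex.exp (∑' k, c k)‖) +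
        ∑ n ∈ Finset.range (M + 1), (n + 1) * (∑' k, ρ k) ^ n) := by
  classical
  set G := ∑' k, ρ k with hG
  set E := ∑' k, c k with hE
  set s := lowValencies M with hs
  set E' := ∑ k ∈ s, c k with hE'
  have hG0 : 0 ≤ G := tsum_nonneg hρ
  -- All weights are at least 1, so every term carries at least one factor ε.
  have hc1 : ∀ k, ‖c k‖ ≤ ε * ρ k := fun k => (hc k).trans (by
    rw [mul_comm]
    exact mul_le_mul_of_nonneg_right (pow_le_of_le_one hε.le hε1 k.pos.ne') (hρ k))
  have hcsum : Summable fun k => ‖c k‖ :=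
    Summable.of_nonneg_of_le (fun _ => norm_nonneg _) hc1 (hsum.mul_left ε)
  have hEε : ‖E‖ ≤ ε * G := by
    rw [hG, ← tsum_mul_left]
    exact tsum_of_norm_bounded (hsum.mul_left ε).hasSum hc1
  have hEG : ‖E‖ ≤ G := hEε.trans (mul_le_of_le_one_left hG0 hε1)
  have hsG : ∑ k ∈ s, ρ k ≤ G := hsum.sum_le_tsum s fun k _ => hρ k
  have hE'G : ‖E'‖ ≤ G := by
    refine (norm_sum_le_of_le _ fun k _ => (hc1 k).trans
      (mul_le_of_le_one_left (hρ k) hε1)).trans hsG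
  have htail : ‖E - E'‖ ≤ ε ^ (M + 1) * G := by
    have h1 : E - E' = ∑' k, if k ∈ s then 0 else c k := by
      have h2 : HasSum (fun k => if k ∈ s then c k else 0) E' := by
        have : HasSum (fun k => if k ∈ s then c k else 0) (∑ k ∈ s, if k ∈ s then c k else 0) :=
          hasSum_sum_of_ne_finset_zero fun k hk => if_neg hk
        rwa [Finset.sum_congr rfl fun k hk => if_pos hk] at this
      rw [← (hcsum.of_norm.hasSum.sub h2).tsum_eq]
      refine tsum_congr fun k => ?_
      split_ifs <;> simp
    rw [h1, hG, ← tsum_mul_left]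
    refine tsum_of_norm_bounded (hsum.mul_left _).hasSum fun k => ?_
    split_ifs with hk
    · rw [norm_zero]; exact mul_nonneg (by positivity) (hρ k)
    · rw [mem_lowValencies, not_le] at hk
      refine (hc k).trans ?_
      rw [mul_comm]
      exact mul_le_mul_of_nonneg_right (pow_le_pow_of_le_one hε.le hε1 hk) (hρ k)
  -- Three errors of order ε^(M+1) add up: Taylor terms of degree above M (`h1`), variables of
  -- weight above M (`h2`), and monomials of low degree in low variables whose total weight still
  -- exceeds M (`h3`).
  have h1 : ‖Complex.exp E - ∑ n ∈ Finset.range (M + 1), E ^ n / n.factorial‖ ≤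
      ε ^ (M + 1) * (G ^ (M + 1) * (M + 4 + ‖Complex.exp E‖)) := by
    refine (norm_exp_sub_sum_le_pow_mul E (M + 1)).trans ?_
    rw [← mul_assoc, ← mul_pow]
    push_cast
    rw [show (M + 1 + 3 : ℝ) = M + 4 by ring]
    gcongr
  have h2 : ‖∑ n ∈ Finset.range (M + 1), E ^ n / n.factorial -
      ∑ n ∈ Finset.range (M + 1), E' ^ n / n.factorial‖ ≤
      ∑ n ∈ Finset.range (M + 1), ε ^ (M + 1) * (n * G ^ n) := by
    rw [← Finset.sum_sub_distrib]
    refine norm_sum_le_of_le _ fun n _ => ?_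
    rw [← sub_div, norm_div, Complex.norm_natCast]
    exact (div_le_self (norm_nonneg _) (by exact_mod_cast n.factorial_pos)).trans
      (norm_pow_sub_pow_le hEG hE'G htail n)
  have h3 : ‖∑ n ∈ Finset.range (M + 1), E' ^ n / n.factorial - ∑ d ∈ weightLE M,
        (d.prod fun k j => c k ^ j) / (d.prod fun _ j => (j.factorial : ℂ))‖ ≤
      ∑ n ∈ Finset.range (M + 1), ε ^ (M + 1) * G ^ n := by
    rw [hE', hs, ← sum_lowExponents, weightLE,
      ← Finset.sum_filter_add_sum_filter_not (lowExponents M) (fun d => halfEdges d ≤ M),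
      add_sub_cancel_left]
    have h4 : ∀ d ∈ (lowExponents M).filter (fun d => ¬ halfEdges d ≤ M),
        ‖(d.prod fun k j => c k ^ j) / (d.prod fun _ j => (j.factorial : ℂ))‖ ≤
        ε ^ (M + 1) * ((d.prod fun k j => ρ k ^ j) / (d.prod fun _ j => (j.factorial : ℝ))) := by
      intro d hd
      have hd' := (Finset.mem_filter.mp hd).2
      have h5 : ‖(d.prod fun _ j => (j.factorial : ℂ))‖ = d.prod fun _ j => (j.factorial : ℝ) := by
        rw [Finsupp.prod, Finsupp.prod, norm_prod]
        exact Finset.prod_congr rfl fun k _ => Complex.norm_natCast _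
      have h6 : (0 : ℝ) ≤ d.prod fun k j => ρ k ^ j :=
        Finset.prod_nonneg fun k _ => pow_nonneg (hρ k) _
      rw [norm_div, h5, ← mul_div_assoc]
      refine div_le_div_of_nonneg_right ?_ (Finset.prod_nonneg fun _ _ => Nat.cast_nonneg _)
      refine (norm_prod_pow_le hc d).trans ?_
      rw [mul_comm]
      exact mul_le_mul_of_nonneg_right (pow_le_pow_of_le_one hε.le hε1 (by omega)) h6
    refine (norm_sum_le_of_le _ h4).trans ?_
    rw [← Finset.mul_sum, ← Finset.mul_sum]
    refine mul_le_mul_of_nonneg_left ?_ (by positivity)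
    refine (Finset.sum_le_sum_of_subset_of_nonneg (Finset.filter_subset _ _)
      fun d _ _ => ?_).trans ?_
    · exact div_nonneg (Finset.prod_nonneg fun k _ => pow_nonneg (hρ k) _)
        (Finset.prod_nonneg fun _ _ => Nat.cast_nonneg _)
    · rw [sum_lowExponents]
      refine Finset.sum_le_sum fun n _ => ?_
      have h7 : 0 ≤ ∑ k ∈ lowValencies M, ρ k := Finset.sum_nonneg fun k _ => hρ k
      exact (div_le_self (pow_nonneg h7 _) (by exact_mod_cast n.factorial_pos)).trans
        (pow_le_pow_left₀ h7 hsG n)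
  refine (norm_sub_le_norm_sub_add_norm_sub _ (∑ n ∈ Finset.range (M + 1), E ^ n / n.factorial)
    _).trans ?_
  rw [mul_add, Finset.mul_sum]
  refine add_le_add h1 ((norm_sub_le_norm_sub_add_norm_sub _
    (∑ n ∈ Finset.range (M + 1), E' ^ n / n.factorial) _).trans ?_)
  refine (add_le_add h2 h3).trans_eq ?_
  rw [← Finset.sum_add_distrib]
  exact Finset.sum_congr rfl fun n _ => by ring

end PointwiseEstimate

/-! ### Integrating the remainder. -/

section AsymptoticExpansion

open MeasureTheory

variable {V : Type*} [NormedAddCommGroup V] [InnerProductSpace ℝ V]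

/-- The dominating function `∑ r_k |S_k(v^{⊗k})| / k!` with values in `[0, ∞]`. -/
noncomputable def majorant (S : SymmetricTensors V ℂ) (r : ℕ+ → ℝ) (v : V) : ENNReal :=
  ∑' k : ℕ+, ENNReal.ofReal (r k * ‖S.diag k v‖ / (k : ℕ).factorial)

/-- Young's inequality with the conjugate exponent rounded up to an integer, because only moments of
integer order are assumed; the 1 covers a ≤ 1. -/
theorem mul_le_pow_add_rpow {q : ℝ} (hq : 1 < q) :
    ∃ N : ℕ, ∀ a b : ℝ, 0 ≤ a → 0 ≤ b → a * b ≤ 1 + a ^ N + b ^ q := by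
  obtain ⟨N, hN⟩ := exists_nat_ge q.conjExponent
  have hpq := (Real.HolderConjugate.conjExponent hq).symm
  refine ⟨N, fun a b ha hb => (Real.young_inequality_of_nonneg ha hb hpq).trans ?_⟩
  have h1 : a ^ q.conjExponent / q.conjExponent ≤ a ^ q.conjExponent :=
    div_le_self (Real.rpow_nonneg ha _) hpq.lt.le
  have h2 : b ^ q / q ≤ b ^ q := div_le_self (Real.rpow_nonneg hb _) hq.le
  have h3 : a ^ q.conjExponent ≤ 1 + a ^ N := by
    rcases le_total a 1 with h | h
    · linarith [Real.rpow_le_one ha h hpq.nonneg, pow_nonneg ha N]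
    · have := Real.rpow_le_rpow_of_exponent_le h hN
      rw [Real.rpow_natCast] at this
      linarith
  linarith

theorem summable_of_majorant_ne_top {S : SymmetricTensors V ℂ} {r : ℕ+ → ℝ} (hr : ∀ k, 0 ≤ r k)
    {v : V} (h : majorant S r v ≠ ⊤) :
    Summable (fun k : ℕ+ => r k * ‖S.diag k v‖ / (k : ℕ).factorial) ∧
      ∑' k : ℕ+, r k * ‖S.diag k v‖ / (k : ℕ).factorial = (majorant S r v).toReal := by
  have hnn : ∀ k : ℕ+, 0 ≤ r k * ‖S.diag k v‖ / (k : ℕ).factorial := fun k =>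
    div_nonneg (mul_nonneg (hr k) (norm_nonneg _)) (Nat.cast_nonneg _)
  have hs := ENNReal.summable_toReal h
  simp_rw [ENNReal.toReal_ofReal (hnn _)] at hs
  refine ⟨hs, ?_⟩
  rw [majorant, ← ENNReal.ofReal_tsum_of_nonneg hnn hs, ENNReal.toReal_ofReal (tsum_nonneg hnn)]

theorem prod_mul_coeff_formalIntegrand (S : SymmetricTensors V ℂ) (x : ℕ+ → ℂ) (v : V)
    (d : ℕ+ →₀ ℕ) :
    (d.prod fun k j => x k ^ j) * MvPowerSeries.coeff d (formalIntegrand S v) =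
      (d.prod fun k j => (x k * (S.diag k v / ((k : ℕ).factorial : ℂ))) ^ j) /
        (d.prod fun _ j => (j.factorial : ℂ)) := by
  rw [formalIntegrand, coeff_exp_subst_linearSeries, ← mul_div_assoc]
  simp_rw [mul_pow]
  rw [Finsupp.prod_mul]

theorem norm_exp_exponent_sub_le {S : SymmetricTensors V ℂ} {r : ℕ+ → ℝ} (hr : ∀ k, 0 ≤ r k)
    {v : V} (h : majorant S r v ≠ ⊤) {x : ℕ+ → ℂ} {ε : ℝ} (hε : 0 < ε) (hε1 : ε ≤ 1)
    (hx : ∀ k : ℕ+, ‖x k‖ ≤ r k * ε ^ (k : ℕ)) (M : ℕ) :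
    ‖Complex.exp (exponent S x v) - ∑ d ∈ weightLE M,
        (d.prod fun k j => x k ^ j) * MvPowerSeries.coeff d (formalIntegrand S v)‖ ≤
      ε ^ (M + 1) * ((majorant S r v).toReal ^ (M + 1) *
          (M + 4 + ‖Complex.exp (exponent S x v)‖) +
        ∑ n ∈ Finset.range (M + 1), (n + 1) * (majorant S r v).toReal ^ n) := by
  obtain ⟨h1, h2⟩ := summable_of_majorant_ne_top hr h
  simp_rw [prod_mul_coeff_formalIntegrand]
  rw [← h2]
  refine norm_exp_tsum_sub_sum_weightLE_le (fun k =>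
    div_nonneg (mul_nonneg (hr k) (norm_nonneg _)) (Nat.cast_nonneg _)) h1 hε hε1 (fun k => ?_) M
  rw [norm_mul, norm_div, Complex.norm_natCast, ← mul_div_assoc, div_mul_eq_mul_div,
    mul_right_comm (r k)]
  gcongr
  exact hx k

variable [FiniteDimensional ℝ V]

/-- In coordinates this is a polynomial, so no topology on the complexification is needed. -/
theorem SymmetricTensors.continuous_diag (S : SymmetricTensors V ℂ) (k : ℕ+) :
    Continuous (S.diag k) := by
  have : Nonempty (Fin (k : ℕ)) := ⟨⟨0, k.pos⟩⟩
  have h : ∀ v, S.diag k v = S.eval fun _ : Fin (k : ℕ) => (1 : ℂ) ⊗ₜ[ℝ] v := fun v =>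
    (S.eval_eq (fun _ : Fin (k : ℕ) => (1 : ℂ) ⊗ₜ[ℝ] v) k (Equiv.refl _)).symm
  simp_rw [funext h, S.eval_const_eq_sum (stdOrthonormalBasis ℝ V)]
  fun_prop

variable [MeasurableSpace V] [BorelSpace V]

theorem measurable_majorant (S : SymmetricTensors V ℂ) (r : ℕ+ → ℝ) : Measurable (majorant S r) :=
  Measurable.tsum fun k => by
    have := (S.continuous_diag k).measurable
    fun_prop

theorem aestronglyMeasurable_exponent {S : SymmetricTensors V ℂ} {r : ℕ+ → ℝ} (hr : ∀ k, 0 ≤ r k)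
    {μ : Measure V} (hfin : ∀ᵐ v ∂μ, majorant S r v ≠ ⊤) {x : ℕ+ → ℂ} (hx : ∀ k, ‖x k‖ ≤ r k) :
    AEStronglyMeasurable (exponent S x) μ := by
  refine aestronglyMeasurable_of_tendsto_ae (Filter.atTop : Filter (Finset ℕ+))
    (f := fun s v => ∑ k ∈ s, x k * (S.diag k v / ((k : ℕ).factorial : ℂ))) (fun s => ?_) ?_
  · have := S.continuous_diag
    exact Continuous.aestronglyMeasurable (by fun_prop)
  · filter_upwards [hfin] with v hv
    refine (Summable.of_norm_bounded (summable_of_majorant_ne_top hr hv).1 fun k => ?_).hasSum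
    rw [norm_mul, norm_div, Complex.norm_natCast, ← mul_div_assoc]
    gcongr
    exact hx k

theorem exists_asymptotic_bound {ι : Type*} [Fintype ι] (b : OrthonormalBasis ι ℝ V)
    (S : SymmetricTensors V ℂ) (r : ℕ+ → ℝ) (hr : ∀ k, 0 ≤ r k)
    (hmom : ∀ p : ℕ, ∫⁻ v, majorant S r v ^ p ∂(feynmanGaussian V) < ⊤)
    (q : ℝ) (hq : 1 < q) (B : NNReal) (M : ℕ) :
    ∃ C : ℝ, ∀ (x : ℕ+ → ℂ) (ε : ℝ), 0 < ε → ε ≤ 1 →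
      (∀ k : ℕ+, ‖x k‖ ≤ r k * ε ^ (k : ℕ)) →
      (∫⁻ v, ENNReal.ofReal (Real.exp (q * (exponent S x v).re)) ∂(feynmanGaussian V) ≤ B) →
      Integrable (fun v => Complex.exp (exponent S x v)) (feynmanGaussian V) ∧
      ‖(∫ v, Complex.exp (exponent S x v) ∂(feynmanGaussian V)) -
          ∑ γ ∈ GraphClass.upTo M, γ.term b (S.scale x)‖ ≤ C * ε ^ (M + 1) := by
  set μ := feynmanGaussian V
  set g : V → ℝ := fun v => (majorant S r v).toReal with hg
  have hg0 : ∀ v, 0 ≤ g v := fun v => ENNReal.toReal_nonneg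
  have hfin : ∀ᵐ v ∂μ, majorant S r v ≠ ⊤ := by
    have h := ae_lt_top ((measurable_majorant S r).pow_const 1) (hmom 1).ne
    filter_upwards [h] with v hv
    simpa using hv.ne
  have hgint : ∀ p : ℕ, Integrable (fun v => g v ^ p) μ := by
    intro p
    have := integrable_toReal_of_lintegral_ne_top
      ((measurable_majorant S r).pow_const p).aemeasurable (hmom p).ne
    simpa only [ENNReal.toReal_pow] using this
  obtain ⟨N, hN⟩ := mul_le_pow_add_rpow hq
  -- The constant is the integral of the pointwise bound, after Young's inequality replaces g^(M+1)
  -- ‖exp E‖ by 1 + g^((M+1)N) + ‖exp E‖^q, whose last term integrates to at most `B`. It does not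
  -- depend on `x` or `ε`.
  refine ⟨(M + 4) * ∫ v, g v ^ (M + 1) ∂μ + (1 + ∫ v, g v ^ ((M + 1) * N) ∂μ + B) +
    ∑ n ∈ Finset.range (M + 1), (n + 1) * ∫ v, g v ^ n ∂μ, fun x ε hε hε1 hx hB => ?_⟩
  have hmeas : AEStronglyMeasurable (exponent S x) μ :=
    aestronglyMeasurable_exponent hr hfin fun k =>
      (hx k).trans (mul_le_of_le_one_right (hr k) (pow_le_one₀ hε.le hε1))
  have hmeasexp : AEStronglyMeasurable (fun v => Complex.exp (exponent S x v)) μ :=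
    Complex.continuous_exp.comp_aestronglyMeasurable hmeas
  have hmeasq : AEStronglyMeasurable (fun v => Real.exp (q * (exponent S x v).re)) μ :=
    Continuous.comp_aestronglyMeasurable (g := fun z : ℂ => Real.exp (q * z.re))
      (by fun_prop) hmeas
  have hqpos : ∀ v, 0 ≤ Real.exp (q * (exponent S x v).re) := fun v => (Real.exp_pos _).le
  have hintq : Integrable (fun v => Real.exp (q * (exponent S x v).re)) μ := by
    refine ⟨hmeasq, ?_⟩
    rw [hasFiniteIntegral_iff_ofReal (Filter.Eventually.of_forall hqpos)]
    exact hB.trans_lt ENNReal.coe_lt_top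
  have hintqB : ∫ v, Real.exp (q * (exponent S x v).re) ∂μ ≤ B := by
    rw [integral_eq_lintegral_of_nonneg_ae (Filter.Eventually.of_forall hqpos) hmeasq]
    exact ENNReal.toReal_le_coe_of_le_coe hB
  have hrpow : ∀ v, ‖Complex.exp (exponent S x v)‖ ^ q = Real.exp (q * (exponent S x v).re) := by
    intro v
    rw [Complex.norm_exp, ← Real.exp_mul, mul_comm]
  have hint : Integrable (fun v => Complex.exp (exponent S x v)) μ := by
    -- The 2 is 1 + a^N at a = 1.
    refine ((integrable_const 2).add hintq).mono' hmeasexp (Filter.Eventually.of_forall fun v => ?_)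
    have := hN 1 ‖Complex.exp (exponent S x v)‖ zero_le_one (norm_nonneg _)
    rw [hrpow, one_mul, one_pow] at this
    refine this.trans_eq ?_
    simp only [Pi.add_apply]
    norm_num
  refine ⟨hint, ?_⟩
  rw [sum_upTo_term_scale b S x M (weightLE M) fun d => mem_weightLE, ← integral_sub hint
    (integrable_finsetSum _ fun d _ => (integrable_coeff_formalIntegrand S d).const_mul _)]
  have hsumint : Integrable (fun v => ∑ n ∈ Finset.range (M + 1), ((n : ℝ) + 1) * g v ^ n) μ :=
    integrable_finsetSum _ fun n _ => (hgint n).const_mul _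
  have hone : Integrable (fun v => 1 + g v ^ ((M + 1) * N)) μ := (integrable_const 1).add (hgint _)
  have hyoung : Integrable (fun v => 1 + g v ^ ((M + 1) * N) +
      Real.exp (q * (exponent S x v).re)) μ := hone.add hintq
  have hfirst : Integrable (fun v => ((M : ℝ) + 4) * g v ^ (M + 1)) μ := (hgint _).const_mul _
  have hboth : Integrable (fun v => ((M : ℝ) + 4) * g v ^ (M + 1) + (1 + g v ^ ((M + 1) * N) +
      Real.exp (q * (exponent S x v).re))) μ := hfirst.add hyoung
  have hbint : Integrable (fun v => ε ^ (M + 1) * ((M + 4) * g v ^ (M + 1) +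
      (1 + g v ^ ((M + 1) * N) + Real.exp (q * (exponent S x v).re)) +
      ∑ n ∈ Finset.range (M + 1), ((n : ℝ) + 1) * g v ^ n)) μ :=
    (hboth.add hsumint).const_mul _
  refine (norm_integral_le_of_norm_le hbint ?_).trans ?_
  · filter_upwards [hfin] with v hv
    refine (norm_exp_exponent_sub_le hr hv hε hε1 hx M).trans ?_
    refine mul_le_mul_of_nonneg_left ?_ (by positivity)
    refine add_le_add ?_ le_rfl
    rw [mul_add, mul_comm _ ((M : ℝ) + 4)]
    refine add_le_add le_rfl ?_
    have := hN (g v ^ (M + 1)) ‖Complex.exp (exponent S x v)‖ (pow_nonneg (hg0 v) _) (norm_nonneg _)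
    rwa [hrpow, ← pow_mul] at this
  · rw [integral_const_mul, mul_comm]
    refine mul_le_mul_of_nonneg_right ?_ (by positivity)
    rw [integral_add hboth hsumint, integral_add hfirst hyoung, integral_const_mul,
      integral_add hone hintq, integral_add (integrable_const 1) (hgint _),
      integral_finsetSum _ fun n _ => (hgint n).const_mul _]
    simp_rw [integral_const_mul]
    simp only [integral_const, probReal_univ, smul_eq_mul, mul_one]
    gcongr

end AsymptoticExpansion

theorem theorem3 {V : Type*} [NormedAddCommGroup V] [InnerProductSpace ℝ V]
    [FiniteDimensional ℝ V] [MeasurableSpace V] [BorelSpace V]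
    {ι : Type*} [Fintype ι] (b : OrthonormalBasis ι ℝ V) (S : SymmetricTensors V ℂ) :
    -- the identity of formal power series in the variables `x₁, x₂, …`
    ((∀ d : ℕ+ →₀ ℕ, MeasureTheory.Integrable
        (fun v => MvPowerSeries.coeff d (formalIntegrand S v)) (feynmanGaussian V)) ∧
      HasSum (GraphClass.term b (S.scale fun k => (MvPowerSeries.X k : MvPowerSeries ℕ+ ℂ)))
        (formalPartition S)) ∧
    -- the asymptotic expansion of the actual integral as `x → 0`
    (∀ r : ℕ+ → ℝ, (∀ k, 0 ≤ r k) →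
      (∀ p : ℕ, ∫⁻ v, (∑' k : ℕ+, ENNReal.ofReal (r k * ‖S.diag k v‖ / (k : ℕ).factorial)) ^ p
        ∂(feynmanGaussian V) < ⊤) →
      ∀ q : ℝ, 1 < q → ∀ (B : NNReal) (M : ℕ),
      ∃ C : ℝ, ∀ (x : ℕ+ → ℂ) (ε : ℝ), 0 < ε → ε ≤ 1 →
        (∀ k : ℕ+, ‖x k‖ ≤ r k * ε ^ (k : ℕ)) →
        (∫⁻ v, ENNReal.ofReal (Real.exp (q * (exponent S x v).re)) ∂(feynmanGaussian V) ≤ B) →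
        MeasureTheory.Integrable (fun v => Complex.exp (exponent S x v)) (feynmanGaussian V) ∧
        ‖(∫ v, Complex.exp (exponent S x v) ∂(feynmanGaussian V)) -
            ∑ γ ∈ GraphClass.upTo M, γ.term b (S.scale x)‖ ≤ C * ε ^ (M + 1)) :=
  ⟨⟨integrable_coeff_formalIntegrand S, hasSum_term_formalPartition b S⟩,
    exists_asymptotic_bound b S⟩
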